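/- Let $n\ge 4$ and let $\mathfrak g$ be the complex simple Lie algebra of type $D_n$, with Cartan subalgebra $\mathfrak h$, simple roots $\alpha_1,\dots,\alpha_n$ (Bourbaki numbering), positive roots $R^+$, Chevalley generators $x_\alpha^\pm,h_\alpha$ ($\alpha\in R^+$; $x_i^\pm=x_{\alpha_i}^\pm$, $h_i=h_{\alpha_i}$), weight lattice $P$, dominant weights $P^+$, and $P^+(1)=\{\lambda\in P:0\le\lambda(h_i)\le 1\text{ for all }i\}$. Let $\mathfrak g[t]=\mathfrak g\otimes\mathbb C[t]$, graded by $\deg(x\otimes t^r)=r$. All modules are $\mathbb Z$-graded $\mathfrak g[t]$-modules, morphisms have degree $0$, and $\tau_s^*M$ is $M$ with all graded pieces moved up by $s$, i.e. $(\tau_s^*M)[k]=M[k-s]$. *Modules.* For $\lambda\in P^+$ the local Weyl relations of weight $\lambda$ on a generator $w$ are $$(x_\alpha^+\otimes t^r)w=0,\quad (h\otimes t^r)w=\delta_{r,0}\lambda(h)w,\quad (x_i^-\otimes 1)^{\lambda(h_i)+1}w=0\qquad(\alpha\in R^+,\ h\in\mathfrak h,\ r\ge0,\ 1\le i\le n).$$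 For $\lambda,\mu\in P^+$, $V(\lambda,\mu)$ is the module generated by an element $v_{\lambda,\mu}$ of degree $0$ with the local Weyl relations of weight $\lambda+\mu$ and $$(x_\alpha^-\otimes t^{p_\alpha})v_{\lambda,\mu}=0,\quad p_\alpha=\max\{\lambda(h_\alpha),\mu(h_\alpha)\},\qquad \alpha\in R^+.$$ For $\ell\ge1$ and $\lambda\in P^+$, the stable Demazure module $D(\ell,\lambda)$ is the module generated by an element $w_\lambda$ of degree $0$ with the local Weyl relations of weight $\lambda$ and, for $\alpha\in R^+$, $$(x_\alpha^-\otimes t^{s_\alpha})w_\lambda=0,\qquad (x_\alpha^-\otimes t^{s_\alpha-1})^{m_\alpha+1}w_\lambda=0\ \text{ if } s_\alpha\ge1,$$ where $\lambda(h_\alpha)=\ell(s_\alpha-1)+m_\alpha$ with $s_\alpha\in\mathbb Z_{\ge0}$, $0<m_\alpha\le\ell$. *Interlacing pairs.* A pair $\lambda_1,\lambda_2\in P^+(1)$ is interlacing if $\lambda_1+\lambda_2\in P^+(1)$ and, for $\{r,p\}=\{1,2\}$: (a) $\lambda_r(h_{n-1}+h_n)>0$ implies $\lambda_p(h_{n-1}+h_n)=0$;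 (b) for all $1\le i<j\le n$ with $(i,j)\ne(n-1,n)$, $\lambda_r(h_i)=1=\lambda_r(h_j)$ implies $\lambda_p(h_s)=1$ for some $i<s<j$. For $1\le i<j\le n-1$ let $$\beta_{i,j}=\alpha_i+\dots+\alpha_{j-1}+2(\alpha_j+\dots+\alpha_{n-2})+\alpha_{n-1}+\alpha_n\in R^+,$$ and let $R(\lambda_1,\lambda_2)=\{\beta_{i,j}:(\lambda_1-\lambda_2)(h_{\beta_{i,j}})=\pm2\}$. If $R(\lambda_1,\lambda_2)\ne\emptyset$, let $\beta_{\lambda_1,\lambda_2}$ be the (unique) element of $R(\lambda_1,\lambda_2)$ such that for every other $\gamma\in R(\lambda_1,\lambda_2)$ the difference $\gamma-\beta_{\lambda_1,\lambda_2}$ is a positive root or a sum of two positive roots. **Proposition.** Let $(\lambda_1,\lambda_2)$ be an interlacing pair in $P^+(1)\times P^+(1)$ with $R(\lambda_1,\lambda_2)\neq\emptyset$, put $\beta=\beta_{\lambda_1,\lambda_2}$, and let the pair be labelled so that $\lambda_1(h_\beta)>\lambda_2(h_\beta)$. Let $\nu\in P^+$ and $s=(\nu+\lambda_1)(h_\beta)-1\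 (\geq 0)$. Then $\lambda_1+\nu-\beta\in P^+$, and the assignments $$v_{\lambda_1+\nu-\beta,\lambda_2+\nu}\mapsto(x_\beta^-\otimes t^{s})\,v_{\lambda_1+\nu,\lambda_2+\nu},\qquad v_{\lambda_1+\nu,\lambda_2+\nu}\mapsto w_{\lambda_1+\lambda_2+2\nu}$$ define a right exact sequence of graded $\mathfrak g[t]$-modules $$\tau_s^*V(\lambda_1+\nu-\beta,\lambda_2+\nu)\to V(\lambda_1+\nu,\lambda_2+\nu)\to D(2,\lambda_1+\lambda_2+2\nu)\to0.$$ -/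

import Mathlib

open scoped TensorProduct

noncomputable section

namespace TypeD

attribute [local instance 100] LieRing.ofAssociativeRing

/-! ### The simple Lie algebra of type `D_n` -/

/-- The complex simple Lie algebra of type `D_n`: the matrices `[A, B; C, -Aᵀ]` of size `2n` with
`B` and `C` skew-symmetric. -/
abbrev g (n : ℕ) : LieSubalgebra ℂ (Matrix (Fin n ⊕ Fin n) (Fin n ⊕ Fin n) ℂ) :=
  LieAlgebra.Orthogonal.typeD (Fin n) ℂ

/-- The positive roots of type `D_n`: `sub i j` is `ε_i - ε_j` and `add i j` is `ε_i + ε_j`,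
for `i < j`. Indices are counted from `0`, so the simple roots are
`α_k = ε_k - ε_{k+1}` for `k < n - 1` and `α_{n-1} = ε_{n-2} + ε_{n-1}`. -/
inductive PosRoot (n : ℕ) : Type
  | sub (i j : Fin n) (h : i < j) : PosRoot n
  | add (i j : Fin n) (h : i < j) : PosRoot n

namespace PosRoot

variable {n : ℕ}

/-- The coefficients of a positive root in the basis of simple roots:
`ε_i - ε_j = ∑_{i ≤ k < j} α_k` and, counting from `0`,
`ε_i + ε_j = ∑_{i ≤ k < n - 2} α_k + α_{n-1} + ∑_{j ≤ k < n - 1} α_k`. -/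
def coeff : PosRoot n → Fin n → ℕ
  | sub i j _, k => if i ≤ k ∧ k < j then 1 else 0
  | add i j _, k => (if i ≤ k ∧ (k : ℕ) + 2 < n then 1 else 0) +
      (if (k : ℕ) + 1 = n then 1 else 0) + (if j ≤ k ∧ (k : ℕ) + 1 < n then 1 else 0)

/-- A positive root is simple if it is one of the `α_k`. -/
def IsSimple (α : PosRoot n) : Prop := ∃ k : Fin n, α.coeff = Pi.single k 1

end PosRoot

open PosRoot

variable {n : ℕ}

theorem mem_g_iff (A B C D : Matrix (Fin n) (Fin n) ℂ) :
    Matrix.fromBlocks A B C D ∈ g n ↔ D = -A.transpose ∧ B.transpose = -B ∧ C.transpose = -C := by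
  rw [g, LieAlgebra.Orthogonal.typeD, mem_skewAdjointMatricesLieSubalgebra,
    mem_skewAdjointMatricesSubmodule]
  simp only [Matrix.IsSkewAdjoint, Matrix.IsAdjointPair, LieAlgebra.Orthogonal.JD,
    Matrix.fromBlocks_transpose, Matrix.fromBlocks_multiply, Matrix.fromBlocks_neg]
  simp only [Matrix.mul_zero, Matrix.mul_one, Matrix.zero_mul, Matrix.one_mul, zero_add, add_zero,
    Matrix.fromBlocks_inj]
  constructor
  · rintro ⟨h1, h2, h3, h4⟩
    refine ⟨?_, h4, h1⟩
    rw [h2, neg_neg]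
  · rintro ⟨h1, h2, h3⟩
    refine ⟨h3, ?_, ?_, h2⟩
    · rw [h1, neg_neg]
    · rw [h1]; simp

/-- The root vector `x_α⁺`. -/
def xPlus : PosRoot n → g n
  | sub i j _ => ⟨Matrix.fromBlocks (Matrix.single i j 1) 0 0 (-Matrix.single j i 1),
      (mem_g_iff _ _ _ _).2 ⟨by simp, by simp, by simp⟩⟩
  | add i j _ => ⟨Matrix.fromBlocks 0 (Matrix.single i j 1 - Matrix.single j i 1) 0 0,
      (mem_g_iff _ _ _ _).2 ⟨by simp, by simp, by simp⟩⟩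

/-- The root vector `x_α⁻`. -/
def xMinus : PosRoot n → g n
  | sub i j _ => ⟨Matrix.fromBlocks (Matrix.single j i 1) 0 0 (-Matrix.single i j 1),
      (mem_g_iff _ _ _ _).2 ⟨by simp, by simp, by simp⟩⟩
  | add i j _ => ⟨Matrix.fromBlocks 0 0 (Matrix.single j i 1 - Matrix.single i j 1) 0,
      (mem_g_iff _ _ _ _).2 ⟨by simp, by simp, by simp⟩⟩

/-- The coroot `h_α`; the coroots span the Cartan subalgebra of diagonal matrices in `g n`. -/
def coroot : PosRoot n → g n
  | sub i j _ => ⟨Matrix.fromBlocks (Matrix.single i i 1 - Matrix.single j j 1) 0 0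
        (Matrix.single j j 1 - Matrix.single i i 1),
      (mem_g_iff _ _ _ _).2 ⟨by simp, by simp, by simp⟩⟩
  | add i j _ => ⟨Matrix.fromBlocks (Matrix.single i i 1 + Matrix.single j j 1) 0 0
        (-(Matrix.single i i 1 + Matrix.single j j 1)),
      (mem_g_iff _ _ _ _).2 ⟨by simp, by simp, by simp⟩⟩

theorem lie_xPlus_xMinus (α : PosRoot n) : ⁅xPlus α, xMinus α⁆ = coroot α := by
  cases α with
  | sub i j h =>
    ext1
    simp [xPlus, xMinus, coroot, LieSubalgebra.coe_bracket, Ring.lie_def,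
      Matrix.fromBlocks_multiply, Matrix.fromBlocks_neg, Matrix.fromBlocks_add, sub_eq_add_neg]
  | add i j h =>
    ext1
    simp [xPlus, xMinus, coroot, LieSubalgebra.coe_bracket, Ring.lie_def,
      Matrix.fromBlocks_multiply, Matrix.fromBlocks_neg, Matrix.fromBlocks_add, sub_eq_add_neg,
      h.ne, h.ne', Matrix.mul_add, Matrix.add_mul]
    abel

/-! ### Weights -/

/-- The weight lattice `P`: the integral weight `λ` is recorded by the integers `λ(h_k)`, that is,
by its coordinates in the basis of fundamental weights. -/
abbrev Weight (n : ℕ) : Type := Fin n → ℤ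

/-- `λ(h_α)`. As `D_n` is simply laced, `h_α = ∑ c_k h_k` whenever `α = ∑ c_k α_k`. -/
def pair (lam : Weight n) (α : PosRoot n) : ℤ := ∑ k, (α.coeff k : ℤ) * lam k

/-- A positive root as an element of the weight lattice: `α(h_i) = ∑_k c_k α_k(h_i)`. -/
def rootWeight (α : PosRoot n) : Weight n := fun i => ∑ k, CartanMatrix.D n i k * (α.coeff k : ℤ)

/-- `λ ∈ P⁺`. -/
def IsDominant (lam : Weight n) : Prop := ∀ i, 0 ≤ lam i

/-- `λ ∈ P⁺(1)`. -/
def IsDominantOne (lam : Weight n) : Prop := ∀ i, 0 ≤ lam i ∧ lam i ≤ 1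

/-- `λ(h_{n-1} + h_n)` (indices counted from `1`): the sum over the last two nodes. -/
def forkSum (lam : Weight n) : ℤ := ∑ i : Fin n, if n ≤ (i : ℕ) + 2 then lam i else 0

/-- One half of the (symmetric) interlacing condition: it constrains the support of `lam`
by means of `mu`. The pair of the last two nodes is exempt from the second clause. -/
def InterlacedBy (lam mu : Weight n) : Prop :=
  (0 < forkSum lam → forkSum mu = 0) ∧
  ∀ i j : Fin n, i < j → ¬ ((i : ℕ) + 2 = n ∧ (j : ℕ) + 1 = n) → lam i = 1 → lam j = 1 →
    ∃ s, i < s ∧ s < j ∧ mu s = 1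

/-- Interlacing pairs. -/
def IsInterlacing (lam₁ lam₂ : Weight n) : Prop :=
  IsDominantOne (lam₁ + lam₂) ∧ InterlacedBy lam₁ lam₂ ∧ InterlacedBy lam₂ lam₁

/-- The set `R(λ₁, λ₂)` of all `β_{i,j} = ε_i + ε_j`, `1 ≤ i < j ≤ n - 1` (indices counted from
`1`), such that `(λ₁ - λ₂)(h_{β_{i,j}}) = ± 2`. -/
def RSet (lam₁ lam₂ : Weight n) : Set (PosRoot n) :=
  {γ | (∃ (i j : Fin n) (h : i < j), (j : ℕ) + 1 < n ∧ γ = add i j h) ∧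
    (pair (lam₁ - lam₂) γ = 2 ∨ pair (lam₁ - lam₂) γ = -2)}

/-- `β = β_{λ₁,λ₂}`: the element of `R(λ₁, λ₂)` such that `γ - β` is a positive root or a sum of two
positive roots for every other `γ ∈ R(λ₁, λ₂)`. -/
def IsBeta (lam₁ lam₂ : Weight n) (β : PosRoot n) : Prop :=
  β ∈ RSet lam₁ lam₂ ∧ ∀ γ ∈ RSet lam₁ lam₂, γ = β ∨
    (∃ δ : PosRoot n, γ.coeff = β.coeff + δ.coeff) ∨
    (∃ δ ε : PosRoot n, γ.coeff = β.coeff + δ.coeff + ε.coeff)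

/-! The rest of this section checks that `β_{λ₁,λ₂}` is well defined. -/

/-- Extension of a weight by zero to all natural numbers. -/
def ext0 (d : Weight n) (k : ℕ) : ℤ := if h : k < n then d ⟨k, h⟩ else 0

theorem pair_add (d : Weight n) (i j : Fin n) (h : i < j) (hj : (j : ℕ) + 1 < n) :
    pair d (add i j h) = (∑ k ∈ Finset.Ico (i : ℕ) (n - 2), ext0 d k) +
      (∑ k ∈ Finset.Ico (j : ℕ) (n - 2), ext0 d k) + ext0 d (n - 2) + ext0 d (n - 1) := by
  have hIco : ∀ a b : ℕ, b ≤ n → ∑ k ∈ Finset.Ico a b, ext0 d k =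
      ∑ k ∈ Finset.range n, if a ≤ k ∧ k < b then ext0 d k else 0 := by
    intro a b hb
    rw [← Finset.sum_filter]
    refine Finset.sum_congr ?_ fun _ _ => rfl
    ext k
    simp only [Finset.mem_Ico, Finset.mem_filter, Finset.mem_range]
    omega
  have hpt : ∀ a : ℕ, a < n → ext0 d a = ∑ k ∈ Finset.range n, if k = a then ext0 d k else 0 := by
    intro a ha
    rw [Finset.sum_ite_eq' (Finset.range n) a, if_pos (Finset.mem_range.2 ha)]
  rw [hIco _ _ (Nat.sub_le _ _), hIco _ _ (Nat.sub_le _ _), hpt (n - 2) (by omega),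
    hpt (n - 1) (by omega), ← Finset.sum_add_distrib, ← Finset.sum_add_distrib,
    ← Finset.sum_add_distrib, Finset.sum_range, pair]
  refine Finset.sum_congr rfl fun k _ => ?_
  have hk : ext0 d (k : ℕ) = d k := by simp [ext0]
  have hij : (i : ℕ) < j := h
  rw [hk]
  simp only [coeff, Fin.le_def]
  split_ifs <;> omega

theorem ext0_alternating {lam₁ lam₂ : Weight n} (h₁ : IsDominantOne lam₁) (h₂ : IsDominantOne lam₂)
    (hint : IsInterlacing lam₁ lam₂) {i j : ℕ} (hij : i < j) (hi : i + 2 < n) {e : ℤ}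
    (he : e = 1 ∨ e = -1) (hdi : ext0 (lam₁ - lam₂) i = e) (hdj : ext0 (lam₁ - lam₂) j = e) :
    ∃ s, i < s ∧ s < j ∧ ext0 (lam₁ - lam₂) s ≠ 0 := by
  have hin : i < n := by omega
  have hjn : j < n := by
    by_contra hj
    rw [ext0, dif_neg hj] at hdj
    omega
  rw [ext0, dif_pos hin, Pi.sub_apply] at hdi
  rw [ext0, dif_pos hjn, Pi.sub_apply] at hdj
  obtain ⟨hsum, h12, h21⟩ := hint
  have a1 := h₁ ⟨i, hin⟩
  have a2 := h₂ ⟨i, hin⟩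
  have b1 := h₁ ⟨j, hjn⟩
  have b2 := h₂ ⟨j, hjn⟩
  have hnf : ¬ (((⟨i, hin⟩ : Fin n) : ℕ) + 2 = n ∧ ((⟨j, hjn⟩ : Fin n) : ℕ) + 1 = n) := by
    simp only; omega
  rcases he with rfl | rfl
  · obtain ⟨s, hs1, hs2, hs3⟩ := h12.2 ⟨i, hin⟩ ⟨j, hjn⟩ hij hnf (by omega) (by omega)
    refine ⟨s, hs1, hs2, ?_⟩
    have c := hsum s
    have c1 := h₁ s
    rw [Pi.add_apply] at c
    rw [ext0, dif_pos s.2, Pi.sub_apply, Fin.eta]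
    omega
  · obtain ⟨s, hs1, hs2, hs3⟩ := h21.2 ⟨i, hin⟩ ⟨j, hjn⟩ hij hnf (by omega) (by omega)
    refine ⟨s, hs1, hs2, ?_⟩
    have c := hsum s
    have c1 := h₂ s
    rw [Pi.add_apply] at c
    rw [ext0, dif_pos s.2, Pi.sub_apply, Fin.eta]
    omega

theorem ext0_fork {lam₁ lam₂ : Weight n} (hn : 2 ≤ n) (h₁ : IsDominantOne lam₁)
    (h₂ : IsDominantOne lam₂) (hint : IsInterlacing lam₁ lam₂) :
    (0 ≤ ext0 (lam₁ - lam₂) (n - 2) ∧ 0 ≤ ext0 (lam₁ - lam₂) (n - 1) ∧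
      ext0 (lam₁ - lam₂) (n - 2) ≤ 1 ∧ ext0 (lam₁ - lam₂) (n - 1) ≤ 1) ∨
    (ext0 (lam₁ - lam₂) (n - 2) ≤ 0 ∧ ext0 (lam₁ - lam₂) (n - 1) ≤ 0 ∧
      -1 ≤ ext0 (lam₁ - lam₂) (n - 2) ∧ -1 ≤ ext0 (lam₁ - lam₂) (n - 1)) := by
  have hf : ∀ d : Weight n, forkSum d = ext0 d (n - 2) + ext0 d (n - 1) := by
    intro d
    have hpt : ∀ a : ℕ, a < n →
        ext0 d a = ∑ k ∈ Finset.range n, if k = a then ext0 d k else 0 := by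
      intro a ha
      rw [Finset.sum_ite_eq' (Finset.range n) a, if_pos (Finset.mem_range.2 ha)]
    rw [hpt (n - 2) (by omega), hpt (n - 1) (by omega), ← Finset.sum_add_distrib, Finset.sum_range,
      forkSum]
    refine Finset.sum_congr rfl fun k _ => ?_
    have hk : ext0 d (k : ℕ) = d k := by simp [ext0]
    rw [hk]
    split_ifs <;> omega
  have hsub : ∀ k, ext0 (lam₁ - lam₂) k = ext0 lam₁ k - ext0 lam₂ k := by
    intro k
    unfold ext0
    split_ifs <;> simp
  have hb : ∀ (d : Weight n), IsDominantOne d → ∀ k, 0 ≤ ext0 d k ∧ ext0 d k ≤ 1 := by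
    intro d hd k
    unfold ext0
    split_ifs with hk
    · exact hd _
    · omega
  obtain ⟨-, ⟨h12, -⟩, -⟩ := hint
  rw [hf, hf] at h12
  rw [hsub, hsub]
  have a := hb _ h₁ (n - 2)
  have b := hb _ h₁ (n - 1)
  have c := hb _ h₂ (n - 2)
  have e := hb _ h₂ (n - 1)
  omega

theorem tail_sums {lam₁ lam₂ : Weight n} (hn : 2 ≤ n) (h₁ : IsDominantOne lam₁)
    (h₂ : IsDominantOne lam₂) (hint : IsInterlacing lam₁ lam₂) (m : ℕ) :
    m + 2 ≤ n → (∀ k, n - 2 - m ≤ k → ext0 (lam₁ - lam₂) k = 0) ∨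
    ∃ e : ℤ, (e = 1 ∨ e = -1) ∧
      (ext0 (lam₁ - lam₂) (n - 2) + ext0 (lam₁ - lam₂) (n - 1) = 0 ∨
        ext0 (lam₁ - lam₂) (n - 2) + ext0 (lam₁ - lam₂) (n - 1) = -e ∨
        ext0 (lam₁ - lam₂) (n - 2) + ext0 (lam₁ - lam₂) (n - 1) = -2 * e) ∧
      (∀ j, n - 2 - m ≤ j → (∑ k ∈ Finset.Ico j (n - 2), ext0 (lam₁ - lam₂) k) = 0 ∨
        (∑ k ∈ Finset.Ico j (n - 2), ext0 (lam₁ - lam₂) k) = e) ∧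
      ∃ k, n - 2 - m ≤ k ∧ (∀ s, n - 2 - m ≤ s → s < k → ext0 (lam₁ - lam₂) s = 0) ∧
        (((∑ k ∈ Finset.Ico (n - 2 - m) (n - 2), ext0 (lam₁ - lam₂) k) = e ∧
            ext0 (lam₁ - lam₂) k = e) ∨
          ((∑ k ∈ Finset.Ico (n - 2 - m) (n - 2), ext0 (lam₁ - lam₂) k) = 0 ∧
            ext0 (lam₁ - lam₂) k = -e)) := by
  set f := ext0 (lam₁ - lam₂) with hfdef
  have hvan : ∀ k, n ≤ k → f k = 0 := fun k hk => by rw [hfdef, ext0, dif_neg (by omega)]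
  have hbd : ∀ k, f k = 0 ∨ f k = 1 ∨ f k = -1 := by
    intro k
    by_cases hk : k < n
    · have a1 := h₁ ⟨k, hk⟩
      have a2 := h₂ ⟨k, hk⟩
      rw [hfdef, ext0, dif_pos hk, Pi.sub_apply]
      omega
    · exact Or.inl (hvan k (by omega))
  have halt : ∀ {i j : ℕ}, i < j → i + 2 < n → ∀ {e : ℤ}, (e = 1 ∨ e = -1) → f i = e → f j = e →
      ∃ s, i < s ∧ s < j ∧ f s ≠ 0 :=
    fun hij hi _ he hdi hdj => ext0_alternating h₁ h₂ hint hij hi he hdi hdj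
  have hfork := ext0_fork hn h₁ h₂ hint
  rw [← hfdef] at hfork
  clear_value f
  induction m with
  | zero =>
    intro _
    simp only [Nat.sub_zero, Finset.Ico_self, Finset.sum_empty]
    have hz : ∀ j, n - 2 ≤ j → Finset.Ico j (n - 2) = ∅ := fun j hj => Finset.Ico_eq_empty (by omega)
    by_cases h0 : f (n - 2) = 0
    · by_cases h1 : f (n - 1) = 0
      · left
        intro k hk
        obtain rfl | rfl | hk' : k = n - 2 ∨ k = n - 1 ∨ n ≤ k := by omega
        · exact h0
        · exact h1
        · exact hvan k hk'
      · right
        refine ⟨-f (n - 1), by have := hbd (n - 1); omega, by omega, ?_, n - 1, by omega, ?_, ?_⟩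
        · intro j hj; left; rw [hz j hj, Finset.sum_empty]
        · intro s hs hs'
          obtain rfl : s = n - 2 := by omega
          exact h0
        · right; simp
    · right
      refine ⟨-f (n - 2), by have := hbd (n - 2); omega, by omega, ?_, n - 2, le_rfl, ?_, ?_⟩
      · intro j hj; left; rw [hz j hj, Finset.sum_empty]
      · intro s hs hs'; omega
      · right; simp
  | succ m ih =>
    intro hm
    specialize ih (by omega)
    obtain ⟨q, hq⟩ : ∃ q, q = n - 2 - (m + 1) := ⟨_, rfl⟩
    have hq' : n - 2 - m = q + 1 := by omega
    rw [hq'] at ih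
    rw [← hq]
    have hstep : ∑ k ∈ Finset.Ico q (n - 2), f k =
        f q + ∑ k ∈ Finset.Ico (q + 1) (n - 2), f k :=
      Finset.sum_eq_sum_Ico_succ_bot (by omega) _
    rcases ih with h0 | ⟨e, he, hfe, hA, k, hk, hks, hk'⟩
    · have hz : ∀ j, q + 1 ≤ j → ∑ k ∈ Finset.Ico j (n - 2), f k = 0 := fun j hj =>
        Finset.sum_eq_zero fun k hk => h0 k (by rw [Finset.mem_Ico] at hk; omega)
      by_cases hd : f q = 0
      · left
        intro k hk
        obtain rfl | hk' : k = q ∨ q + 1 ≤ k := by omega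
        · exact hd
        · exact h0 k hk'
      · right
        refine ⟨f q, by have := hbd q; omega, ?_, ?_, q, le_rfl, ?_, ?_⟩
        · left; rw [h0 (n - 2) (by omega), h0 (n - 1) (by omega), add_zero]
        · intro j hj
          obtain rfl | hj' : j = q ∨ q + 1 ≤ j := by omega
          · right; rw [hstep, hz _ le_rfl, add_zero]
          · left; exact hz j hj'
        · intro s hs hs'; omega
        · left; rw [hstep, hz _ le_rfl, add_zero]; exact ⟨rfl, rfl⟩
    · right
      have hno : f q ≠ 0 → f q ≠ f k := by
        intro h0 hqk
        obtain ⟨s, hs1, hs2, hs3⟩ := halt (show q < k by omega) (by omega)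
          (show f k = 1 ∨ f k = -1 by have := hbd k; omega) hqk rfl
        exact hs3 (hks s (by omega) hs2)
      have hbq := hbd q
      refine ⟨e, he, hfe, ?_, ?_⟩
      · intro j hj
        obtain rfl | hj' : j = q ∨ q + 1 ≤ j := by omega
        · rw [hstep]; omega
        · exact hA j hj'
      · by_cases h0 : f q = 0
        · refine ⟨k, by omega, ?_, ?_⟩
          · intro s hs hs'
            obtain rfl | hs'' : s = q ∨ q + 1 ≤ s := by omega
            · exact h0
            · exact hks s hs'' hs'
          · rw [hstep, h0, zero_add]; exact hk'
        · refine ⟨q, le_rfl, fun s hs hs' => by omega, ?_⟩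
          rw [hstep]; omega

theorem rset_structure {lam₁ lam₂ : Weight n} (h₁ : IsDominantOne lam₁) (h₂ : IsDominantOne lam₂)
    (hint : IsInterlacing lam₁ lam₂) : RSet lam₁ lam₂ = ∅ ∨
    ∃ S : Set (Fin n), ∀ (i j : Fin n) (h : i < j), (j : ℕ) + 1 < n →
      (add i j h ∈ RSet lam₁ lam₂ ↔ i ∈ S ∧ j ∈ S) := by
  by_cases hn : 2 ≤ n
  swap
  · left
    rw [Set.eq_empty_iff_forall_notMem]
    rintro γ ⟨⟨i, j, h, hj, -⟩, -⟩
    have : (i : ℕ) < j := h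
    omega
  have hmem : ∀ (i j : Fin n) (h : i < j), (j : ℕ) + 1 < n → (add i j h ∈ RSet lam₁ lam₂ ↔
      (pair (lam₁ - lam₂) (add i j h) = 2 ∨ pair (lam₁ - lam₂) (add i j h) = -2)) :=
    fun i j h hj => ⟨fun hx => hx.2, fun hx => ⟨⟨i, j, h, hj, rfl⟩, hx⟩⟩
  rcases tail_sums hn h₁ h₂ hint (n - 2) (by omega) with h0 | ⟨e, he, hfe, hA, -⟩
  · right
    refine ⟨∅, fun i j h hj => ?_⟩
    have hz : ∀ j, ∑ k ∈ Finset.Ico j (n - 2), ext0 (lam₁ - lam₂) k = 0 := fun j =>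
      Finset.sum_eq_zero fun k hk => h0 k (by omega)
    rw [hmem i j h hj, pair_add _ _ _ _ hj, hz, hz, h0 _ (by omega), h0 _ (by omega)]
    simp
  · rcases hfe with hf | hf | hf
    · right
      refine ⟨{i | ∑ k ∈ Finset.Ico (i : ℕ) (n - 2), ext0 (lam₁ - lam₂) k = e}, fun i j h hj => ?_⟩
      rw [hmem i j h hj, pair_add _ _ _ _ hj]
      have hi' := hA i (by omega)
      have hj' := hA j (by omega)
      simp only [Set.mem_ofPred_eq]
      omega
    · left
      rw [Set.eq_empty_iff_forall_notMem]
      rintro γ ⟨⟨i, j, h, hj, rfl⟩, hγ⟩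
      rw [pair_add _ _ _ _ hj] at hγ
      have hi' := hA i (by omega)
      have hj' := hA j (by omega)
      omega
    · right
      refine ⟨{i | ∑ k ∈ Finset.Ico (i : ℕ) (n - 2), ext0 (lam₁ - lam₂) k = 0}, fun i j h hj => ?_⟩
      rw [hmem i j h hj, pair_add _ _ _ _ hj]
      have hi' := hA i (by omega)
      have hj' := hA j (by omega)
      simp only [Set.mem_ofPred_eq]
      omega

theorem coeff_add_of_le {i j i₀ j₀ : Fin n} (h : i < j) (h₀ : i₀ < j₀) (hj₀ : (j₀ : ℕ) + 1 < n)
    (hi : i ≤ i₀) (hj : j ≤ j₀) (k : Fin n) :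
    (add i j h).coeff k = (add i₀ j₀ h₀).coeff k + (if i ≤ k ∧ k < i₀ then 1 else 0) +
      (if j ≤ k ∧ k < j₀ then 1 else 0) := by
  simp only [coeff, Fin.le_def, Fin.lt_def] at *
  split_ifs <;> omega

theorem coeff_ne_zero (δ : PosRoot n) : ∃ k, 0 < δ.coeff k := by
  cases δ with
  | sub i j h => exact ⟨i, by simp [coeff, h]⟩
  | add i j h =>
    have hi : (i : ℕ) < j := h
    refine ⟨⟨n - 1, by omega⟩, ?_⟩
    have : n - 1 + 1 = n := by omega
    simp [coeff, this]

/-- If `R(λ₁, λ₂)` is non-empty then `β_{λ₁,λ₂}` exists and is unique. -/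
theorem existsUnique_isBeta {lam₁ lam₂ : Weight n} (h₁ : IsDominantOne lam₁)
    (h₂ : IsDominantOne lam₂) (hint : IsInterlacing lam₁ lam₂) (hR : (RSet lam₁ lam₂).Nonempty) :
    ∃! β, IsBeta lam₁ lam₂ β := by
  obtain hE | ⟨S, hS⟩ := rset_structure h₁ h₂ hint
  · exact absurd hE hR.ne_empty
  classical
  have hex : ∃ β, IsBeta lam₁ lam₂ β := by
    obtain ⟨γ₀, hγ₀⟩ := hR
    obtain ⟨⟨i₁, j₁, h₁₁, hj₁, rfl⟩, -⟩ := id hγ₀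
    have hS₁ := (hS i₁ j₁ h₁₁ hj₁).1 hγ₀
    let F : Finset (Fin n) := Finset.univ.filter fun j => j ∈ S ∧ (j : ℕ) + 1 < n
    have hF : F.Nonempty := ⟨j₁, by simp [F, hS₁.2, hj₁]⟩
    obtain ⟨hj₀S, hj₀⟩ : F.max' hF ∈ S ∧ ((F.max' hF : Fin n) : ℕ) + 1 < n := by
      simpa [F] using F.max'_mem hF
    have hFmax : ∀ j ∈ S, (j : ℕ) + 1 < n → j ≤ F.max' hF := fun j hj hj' =>
      F.le_max' j (by simp [F, hj, hj'])
    generalize F.max' hF = j₀ at hj₀S hj₀ hFmax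
    let G : Finset (Fin n) := Finset.univ.filter fun i => i ∈ S ∧ i < j₀
    have hG : G.Nonempty :=
      ⟨i₁, by simpa [G, hS₁.1] using lt_of_lt_of_le h₁₁ (hFmax _ hS₁.2 hj₁)⟩
    obtain ⟨hi₀S, hi₀⟩ : G.max' hG ∈ S ∧ G.max' hG < j₀ := by simpa [G] using G.max'_mem hG
    have hGmax : ∀ i ∈ S, i < j₀ → i ≤ G.max' hG := fun i hi hi' =>
      G.le_max' i (by simp [G, hi, hi'])
    generalize G.max' hG = i₀ at hi₀S hi₀ hGmax
    refine ⟨add i₀ j₀ hi₀, (hS _ _ _ hj₀).2 ⟨hi₀S, hj₀S⟩, ?_⟩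
    intro γ hγ
    obtain ⟨⟨i, j, h, hj, rfl⟩, -⟩ := id hγ
    obtain ⟨hiS, hjS⟩ := (hS i j h hj).1 hγ
    have hjle : j ≤ j₀ := hFmax j hjS hj
    have hile : i ≤ i₀ := hGmax i hiS (lt_of_lt_of_le h hjle)
    have hc := coeff_add_of_le h hi₀ hj₀ hile hjle
    rcases hile.eq_or_lt with rfl | hi <;> rcases hjle.eq_or_lt with rfl | hj'
    · left; rfl
    · right; left
      refine ⟨sub j j₀ hj', ?_⟩
      ext k
      have : ¬ (i ≤ k ∧ k < i) := fun h => absurd h.2 (not_lt.2 h.1)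
      rw [hc k, if_neg this, add_zero]; rfl
    · right; left
      refine ⟨sub i i₀ hi, ?_⟩
      ext k
      have : ¬ (j ≤ k ∧ k < j) := fun h => absurd h.2 (not_lt.2 h.1)
      rw [hc k, if_neg this, add_zero]; rfl
    · right; right
      refine ⟨sub i i₀ hi, sub j j₀ hj', ?_⟩
      ext k
      rw [hc k]; rfl
  obtain ⟨β, hβ⟩ := hex
  refine ⟨β, hβ, fun β' hβ' => ?_⟩
  have key : ∀ {a b : PosRoot n}, IsBeta lam₁ lam₂ a → IsBeta lam₁ lam₂ b → b = a ∨
      (∀ k, a.coeff k ≤ b.coeff k) ∧ ∃ k, a.coeff k < b.coeff k := by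
    intro a b ha hb
    rcases ha.2 b hb.1 with h | ⟨δ, h⟩ | ⟨δ, ε, h⟩
    · exact Or.inl h
    · right
      obtain ⟨k, hk⟩ := coeff_ne_zero δ
      refine ⟨fun k => ?_, k, ?_⟩ <;> rw [h] <;> simp only [Pi.add_apply] <;> omega
    · right
      obtain ⟨k, hk⟩ := coeff_ne_zero δ
      refine ⟨fun k => ?_, k, ?_⟩ <;> rw [h] <;> simp only [Pi.add_apply] <;> omega
  rcases key hβ hβ' with h | ⟨-, k, hk⟩
  · exact h
  · rcases key hβ' hβ with h | ⟨h, -⟩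
    · exact h.symm
    · exact absurd (h k) (by omega)

/-! ### The current algebra and graded modules -/

/-- The current algebra `g[t] = ℂ[t] ⊗ g`. -/
abbrev Current (n : ℕ) : Type := Polynomial ℂ ⊗[ℂ] g n

/-- The universal enveloping algebra of `g[t]`. A `g[t]`-module is the same as a module over it. -/
abbrev U (n : ℕ) : Type := UniversalEnvelopingAlgebra ℂ (Current n)

/-- The element `x ⊗ t^r` in the enveloping algebra of `g[t]`. -/
def cur (x : g n) (r : ℕ) : U n :=
  UniversalEnvelopingAlgebra.ι ℂ ((Polynomial.X ^ r : Polynomial ℂ) ⊗ₜ[ℂ] x)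

/-- The elements of degree `k` of the enveloping algebra, where `x ⊗ t^r` has degree `r`. -/
def uPiece (n : ℕ) (k : ℤ) : Submodule ℂ (U n) :=
  Submodule.span ℂ {u | ∃ l : List (g n × ℕ),
    ((l.map Prod.snd).sum : ℤ) = k ∧ u = (l.map fun p => cur p.1 p.2).prod}

theorem cur_mem (x : g n) (r : ℕ) : cur x r ∈ uPiece n r :=
  Submodule.subset_span ⟨[(x, r)], by simp, by simp⟩

theorem algebraMap_mem (c : ℂ) : algebraMap ℂ (U n) c ∈ uPiece n 0 := by
  rw [Algebra.algebraMap_eq_smul_one]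
  exact Submodule.smul_mem _ _ (Submodule.subset_span ⟨[], by simp, by simp⟩)

theorem mul_mem_uPiece {k l : ℤ} {u v : U n} (hu : u ∈ uPiece n k) (hv : v ∈ uPiece n l) :
    u * v ∈ uPiece n (k + l) := by
  have h : uPiece n k * uPiece n l ≤ uPiece n (k + l) := by
    rw [uPiece, uPiece, Submodule.span_mul_span, Submodule.span_le]
    rintro _ ⟨_, ⟨l₁, h₁, rfl⟩, _, ⟨l₂, h₂, rfl⟩, rfl⟩
    refine Submodule.subset_span ⟨l₁ ++ l₂, ?_, ?_⟩
    · rw [← h₁, ← h₂]; simp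
    · simp
  exact h (Submodule.mul_mem_mul hu hv)

theorem pow_mem_uPiece {k : ℤ} {u : U n} (hu : u ∈ uPiece n k) (m : ℕ) :
    u ^ m ∈ uPiece n (m * k) := by
  induction m with
  | zero => simpa using algebraMap_mem (n := n) 1
  | succ m ih =>
    rw [pow_succ, show ((m + 1 : ℕ) : ℤ) * k = m * k + k by push_cast; ring]
    exact mul_mem_uPiece ih hu

theorem iSup_uPiece : ⨆ k, uPiece n k = ⊤ := by
  have hle : Subalgebra.toSubmodule (Algebra.adjoin ℂ {u : U n | ∃ x r, u = cur x r}) ≤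
      ⨆ k, uPiece n k := by
    rw [Algebra.adjoin_eq_span, Submodule.span_le]
    intro u hu
    obtain ⟨l, hl, rfl⟩ := Submonoid.exists_list_of_mem_closure hu
    have : ∃ k, l.prod ∈ uPiece n k := by
      clear hu
      induction l with
      | nil => exact ⟨0, by simpa using algebraMap_mem (n := n) 1⟩
      | cons a l ih =>
        obtain ⟨k, hk⟩ := ih fun y hy => hl y (List.mem_cons_of_mem _ hy)
        obtain ⟨x, r, rfl⟩ := hl a List.mem_cons_self
        exact ⟨r + k, by rw [List.prod_cons]; exact mul_mem_uPiece (cur_mem x r) hk⟩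
    obtain ⟨k, hk⟩ := this
    exact (le_iSup (uPiece n) k) hk
  rw [eq_top_iff]
  refine le_trans ?_ hle
  intro u _
  rw [Subalgebra.mem_toSubmodule]
  have hs : Function.Surjective (UniversalEnvelopingAlgebra.mkAlgHom ℂ (Current n)) :=
    RingCon.mkₐ_surjective _
  obtain ⟨a, rfl⟩ := hs u
  clear * -
  induction a using TensorAlgebra.induction with
  | algebraMap c => rw [AlgHom.commutes]; exact Subalgebra.algebraMap_mem _ c
  | ι y =>
    rw [← UniversalEnvelopingAlgebra.ι_apply]
    induction y using TensorProduct.induction_on with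
    | zero => rw [map_zero]; exact Subalgebra.zero_mem _
    | add y z hy hz => rw [map_add]; exact Subalgebra.add_mem _ hy hz
    | tmul p x =>
      induction p using Polynomial.induction_on' with
      | add p q hp hq => rw [TensorProduct.add_tmul, map_add]; exact Subalgebra.add_mem _ hp hq
      | monomial r c =>
        rw [← mul_one c, ← smul_eq_mul, ← Polynomial.smul_monomial, ← TensorProduct.smul_tmul',
          map_smul, Polynomial.monomial_one_right_eq_X_pow]
        exact Subalgebra.smul_mem _ (Algebra.subset_adjoin (s := {u : U n | ∃ x r, u = cur x r})
          ⟨x, r, rfl⟩) c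
  | mul a b ha hb => rw [map_mul]; exact Subalgebra.mul_mem _ ha hb
  | add a b ha hb => rw [map_add]; exact Subalgebra.add_mem _ ha hb

/-- The endomorphism `x ⊗ t^r ↦ 2^r (x ⊗ t^r)`; it is used only to separate the degrees. -/
def scaleU (n : ℕ) : U n →ₐ[ℂ] U n :=
  UniversalEnvelopingAlgebra.lift ℂ ((UniversalEnvelopingAlgebra.ι ℂ).comp
    (LieAlgebra.ExtendScalars.map
      (Polynomial.aeval ((2 : ℂ) • (Polynomial.X : Polynomial ℂ))) (LieHom.id : g n →ₗ⁅ℂ⁆ g n)))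

theorem scaleU_cur (x : g n) (r : ℕ) : scaleU n (cur x r) = (2 : ℂ) ^ r • cur x r := by
  have h : (LieAlgebra.ExtendScalars.map
      (Polynomial.aeval ((2 : ℂ) • (Polynomial.X : Polynomial ℂ))) (LieHom.id : g n →ₗ⁅ℂ⁆ g n))
      ((Polynomial.X ^ r : Polynomial ℂ) ⊗ₜ[ℂ] x) =
      (2 : ℂ) ^ r • ((Polynomial.X ^ r : Polynomial ℂ) ⊗ₜ[ℂ] x) := by
    change (Polynomial.aeval ((2 : ℂ) • (Polynomial.X : Polynomial ℂ)))
      (Polynomial.X ^ r : Polynomial ℂ) ⊗ₜ[ℂ] x = _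
    rw [map_pow, Polynomial.aeval_X, smul_pow, TensorProduct.smul_tmul']
  rw [cur, scaleU, UniversalEnvelopingAlgebra.lift_ι_apply, LieHom.comp_apply, h, map_smul]

theorem scaleU_mem {k : ℤ} {u : U n} (hu : u ∈ uPiece n k) :
    scaleU n u = (2 : ℂ) ^ k • u := by
  induction hu using Submodule.span_induction with
  | zero => simp
  | add u v _ _ hu hv => rw [map_add, hu, hv, smul_add]
  | smul c u _ hu => rw [map_smul, hu, smul_comm]
  | mem u hu =>
    obtain ⟨l, rfl, rfl⟩ := hu
    rw [zpow_natCast]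
    induction l with
    | nil => simp
    | cons a l ih =>
      simp only [List.map_cons, List.prod_cons, List.sum_cons, map_mul, ih, scaleU_cur, pow_add,
        smul_mul_smul_comm]

theorem two_zpow_injective : Function.Injective fun k : ℤ => (2 : ℂ) ^ k := by
  intro k l h
  have h' : (2 : ℝ) ^ k = (2 : ℝ) ^ l := by
    have := congrArg norm h
    simpa using this
  exact zpow_right_injective₀ (by norm_num) (by norm_num) h'

/-- A `ℤ`-graded `g[t]`-module. -/
structure GrMod (n : ℕ) where
  carrier : Type
  [addCommGroup : AddCommGroup carrier]
  [moduleC : Module ℂ carrier]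
  [moduleU : Module (U n) carrier]
  [isScalarTower : IsScalarTower ℂ (U n) carrier]
  /-- the graded pieces -/
  piece : ℤ → Submodule ℂ carrier
  isInternal : DirectSum.IsInternal piece
  cur_smul_mem : ∀ (x : g n) (r : ℕ) (k : ℤ) (v : carrier), v ∈ piece k →
    cur x r • v ∈ piece (k + r)

attribute [instance] GrMod.addCommGroup GrMod.moduleC GrMod.moduleU GrMod.isScalarTower

/-- A morphism of graded `g[t]`-modules: a `g[t]`-linear map of degree zero. -/
structure GrHom (M N : GrMod n) where
  toLin : M.carrier →ₗ[U n] N.carrier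
  map_piece : ∀ (k : ℤ) (v : M.carrier), v ∈ M.piece k → toLin v ∈ N.piece k

/-- The shift `τ_s^* M`: the graded pieces are moved up by `s`. -/
def GrMod.shift (s : ℤ) (M : GrMod n) : GrMod n where
  carrier := M.carrier
  piece k := M.piece (k - s)
  isInternal := by
    have h := M.isInternal
    rw [DirectSum.isInternal_submodule_iff_iSupIndep_and_iSup_eq_top] at h ⊢
    refine ⟨h.1.comp (sub_left_injective), ?_⟩
    rw [← h.2]
    exact (Equiv.subRight s).iSup_comp (g := M.piece)
  cur_smul_mem x r k v hv := by
    have h := M.cur_smul_mem x r (k - s) v hv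
    rwa [show k - s + (r : ℤ) = k + r - s by ring] at h


/-- The degree `k` part of the quotient of the enveloping algebra by a left ideal. -/
def quotPiece (I : Submodule (U n) (U n)) (k : ℤ) : Submodule ℂ (U n ⧸ I) :=
  (uPiece n k).map (I.mkQ.restrictScalars ℂ)

theorem scaleU_mem_span {S : Set (U n)} (hS : ∀ u ∈ S, ∃ k, u ∈ uPiece n k) {u : U n}
    (hu : u ∈ Submodule.span (U n) S) : scaleU n u ∈ Submodule.span (U n) S := by
  induction hu using Submodule.span_induction with
  | zero => rw [map_zero]; exact Submodule.zero_mem _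
  | add u v _ _ hu hv => rw [map_add]; exact Submodule.add_mem _ hu hv
  | smul c u _ hu => rw [smul_eq_mul, map_mul]; exact Submodule.smul_mem _ _ hu
  | mem u hu =>
    obtain ⟨k, hk⟩ := hS u hu
    rw [scaleU_mem hk]
    exact Submodule.smul_of_tower_mem _ _ (Submodule.subset_span hu)

/-- The endomorphism of a quotient of the enveloping algebra induced by `scaleU`. -/
def scaleQuot (I : Submodule (U n) (U n)) (hI : ∀ u ∈ I, scaleU n u ∈ I) :
    Module.End ℂ (U n ⧸ I) where
  toFun := Quotient.map' (scaleU n) fun u v h => by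
    rw [Submodule.quotientRel_def] at h ⊢
    rw [← map_sub]
    exact hI _ h
  map_add' a b := by
    obtain ⟨u, rfl⟩ := Submodule.Quotient.mk_surjective I a
    obtain ⟨v, rfl⟩ := Submodule.Quotient.mk_surjective I b
    change Submodule.Quotient.mk (scaleU n (u + v)) =
      Submodule.Quotient.mk (scaleU n u) + Submodule.Quotient.mk (scaleU n v)
    rw [map_add, Submodule.Quotient.mk_add]
  map_smul' c a := by
    obtain ⟨u, rfl⟩ := Submodule.Quotient.mk_surjective I a
    change Submodule.Quotient.mk (scaleU n (c • u)) = c • Submodule.Quotient.mk (scaleU n u)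
    rw [map_smul, Submodule.Quotient.mk_smul]

theorem scaleQuot_mk (I : Submodule (U n) (U n)) (hI : ∀ u ∈ I, scaleU n u ∈ I) (u : U n) :
    scaleQuot I hI (Submodule.Quotient.mk u) = Submodule.Quotient.mk (scaleU n u) := rfl

theorem quotPiece_le (I : Submodule (U n) (U n)) (hI : ∀ u ∈ I, scaleU n u ∈ I) (k : ℤ) :
    quotPiece I k ≤ (scaleQuot I hI).eigenspace ((2 : ℂ) ^ k) := by
  rintro _ ⟨u, hu, rfl⟩
  rw [Module.End.mem_eigenspace_iff]
  change scaleQuot I hI (Submodule.Quotient.mk u) = _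
  rw [scaleQuot_mk, scaleU_mem hu]
  rfl

theorem iSup_quotPiece (I : Submodule (U n) (U n)) : ⨆ k, quotPiece I k = ⊤ := by
  rw [eq_top_iff]
  intro a _
  obtain ⟨u, rfl⟩ := Submodule.Quotient.mk_surjective I a
  have hu : u ∈ ⨆ k, uPiece n k := by rw [iSup_uPiece]; exact Submodule.mem_top
  induction hu using Submodule.iSup_induction' with
  | mem k u hu => exact Submodule.mem_iSup_of_mem k ⟨u, hu, rfl⟩
  | zero => exact Submodule.zero_mem _
  | add u v _ _ hu hv =>
    exact Submodule.add_mem _ (hu Submodule.mem_top) (hv Submodule.mem_top)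

theorem quotPiece_isInternal {S : Set (U n)} (hS : ∀ u ∈ S, ∃ k, u ∈ uPiece n k) :
    DirectSum.IsInternal (quotPiece (Submodule.span (U n) S)) := by
  rw [DirectSum.isInternal_submodule_iff_iSupIndep_and_iSup_eq_top]
  constructor
  · have hind := (Module.End.eigenspaces_iSupIndep (scaleQuot (Submodule.span (U n) S)
      fun u hu => scaleU_mem_span hS hu)).comp two_zpow_injective
    exact hind.mono fun k => quotPiece_le _ _ k
  · exact iSup_quotPiece _

/-- The cyclic graded `g[t]`-module with a generator of degree zero and with defining relations
`u • generator = 0`, where `u` runs over a set `S` of homogeneous elements of the enveloping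
algebra: the quotient of the enveloping algebra by the left ideal generated by `S`. -/
def presented (S : Set (U n)) (hS : ∀ u ∈ S, ∃ k, u ∈ uPiece n k) : GrMod n where
  carrier := U n ⧸ Submodule.span (U n) S
  piece := quotPiece (Submodule.span (U n) S)
  isInternal := quotPiece_isInternal hS
  cur_smul_mem x r k v hv := by
    obtain ⟨u, hu, rfl⟩ := hv
    refine ⟨cur x r * u, ?_, rfl⟩
    rw [add_comm]
    exact mul_mem_uPiece (cur_mem x r) hu

/-- The generator of a module given by a presentation. -/
def presentedGen (S : Set (U n)) (hS : ∀ u ∈ S, ∃ k, u ∈ uPiece n k) : (presented S hS).carrier :=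
  Submodule.Quotient.mk (1 : U n)

/-! ### The modules `V(λ, μ)` and `D(ℓ, λ)` -/

/-- The relations of the local Weyl module of highest weight `λ`. -/
inductive WeylRel (lam : Weight n) : U n → Prop
  /-- `(x_α⁺ ⊗ t^r) w = 0` -/
  | raising (α : PosRoot n) (r : ℕ) : WeylRel lam (cur (xPlus α) r)
  /-- `(h_α ⊗ t^r) w = δ_{r,0} λ(h_α) w` -/
  | cartan (α : PosRoot n) (r : ℕ) : WeylRel lam
      (cur (coroot α) r - algebraMap ℂ (U n) (if r = 0 then (pair lam α : ℂ) else 0))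
  /-- `(x_i⁻ ⊗ 1)^{λ(h_i) + 1} w = 0` for the simple roots -/
  | lowering (α : PosRoot n) (hα : α.IsSimple) (m : ℕ) (hm : (m : ℤ) = pair lam α) :
      WeylRel lam (cur (xMinus α) 0 ^ (m + 1))

/-- The relations of `V(λ, μ)`: those of the local Weyl module of highest weight `λ + μ`, and
`(x_α⁻ ⊗ t^p) w = 0` for `p = max {λ(h_α), μ(h_α)}`. -/
inductive VRel (lam mu : Weight n) : U n → Prop
  | weyl (u : U n) (hu : WeylRel (lam + mu) u) : VRel lam mu u
  | bound (α : PosRoot n) (p : ℕ) (hp : (p : ℤ) = max (pair lam α) (pair mu α)) :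
      VRel lam mu (cur (xMinus α) p)

/-- The relations of `D(ℓ, λ)`: those of the local Weyl module of highest weight `λ`, and
`(x_α⁻ ⊗ t^s) w = 0`, `(x_α⁻ ⊗ t^{s - 1})^{m + 1} w = 0` (the latter if `s ≥ 1`), where
`λ(h_α) = ℓ (s - 1) + m` and `0 < m ≤ ℓ`. -/
inductive DRel (l : ℕ) (lam : Weight n) : U n → Prop
  | weyl (u : U n) (hu : WeylRel lam u) : DRel l lam u
  | bound (α : PosRoot n) (s m : ℕ) (h : pair lam α = l * ((s : ℤ) - 1) + m) (hm : 0 < m)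
      (hml : m ≤ l) : DRel l lam (cur (xMinus α) s)
  | power (α : PosRoot n) (s m : ℕ) (h : pair lam α = l * ((s : ℤ) - 1) + m) (hm : 0 < m)
      (hml : m ≤ l) (hs : 1 ≤ s) : DRel l lam (cur (xMinus α) (s - 1) ^ (m + 1))

theorem WeylRel.homogeneous {lam : Weight n} {u : U n} (hu : WeylRel lam u) :
    ∃ k, u ∈ uPiece n k := by
  cases hu with
  | raising α r => exact ⟨r, cur_mem _ _⟩
  | cartan α r =>
    refine ⟨r, Submodule.sub_mem _ (cur_mem _ _) ?_⟩
    split_ifs with h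
    · subst h; exact algebraMap_mem _
    · rw [map_zero]; exact Submodule.zero_mem _
  | lowering α hα m hm => exact ⟨_, pow_mem_uPiece (cur_mem _ _) _⟩

theorem VRel.homogeneous {lam mu : Weight n} (u : U n) (hu : u ∈ {u : U n | VRel lam mu u}) :
    ∃ k, u ∈ uPiece n k := by
  cases hu with
  | weyl u hu => exact hu.homogeneous
  | bound α p hp => exact ⟨p, cur_mem _ _⟩

theorem DRel.homogeneous {l : ℕ} {lam : Weight n} (u : U n) (hu : u ∈ {u : U n | DRel l lam u}) :
    ∃ k, u ∈ uPiece n k := by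
  cases hu with
  | weyl u hu => exact hu.homogeneous
  | bound α s m h hm hml => exact ⟨s, cur_mem _ _⟩
  | power α s m h hm hml hs => exact ⟨_, pow_mem_uPiece (cur_mem _ _) _⟩

/-- The graded `g[t]`-module `V(λ, μ)`, for `λ, μ ∈ P⁺`. -/
def V (lam mu : Weight n) : GrMod n := presented ({u : U n | VRel lam mu u}) VRel.homogeneous

/-- The generator of `V(λ, μ)`. -/
def vGen (lam mu : Weight n) : (V lam mu).carrier :=
  presentedGen ({u : U n | VRel lam mu u}) VRel.homogeneous

/-- The stable Demazure module `D(ℓ, λ)` of level `ℓ`, for `λ ∈ P⁺`, by its presentation. -/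
def D (l : ℕ) (lam : Weight n) : GrMod n := presented ({u : U n | DRel l lam u}) DRel.homogeneous

/-- The generator of `D(ℓ, λ)`. -/
def dGen (l : ℕ) (lam : Weight n) : (D l lam).carrier :=
  presentedGen ({u : U n | DRel l lam u}) DRel.homogeneous

end TypeD

end

/-! Put a = λ₁ + ν and b = λ₂ + ν. Interlacing and the choice of β give a simple picture in
orthogonal coordinates: a - b has all coordinates L equal to 0 or 1, and β = ε_p + ε_q, where p < q
are the last two positions at which L is 1 (`IsBeta.exists_coord`). Hence (a - b)(h_α) lies in {-1,
0, 1, 2} for every positive root α. `IsMinimalPair` records this picture, and the module theory uses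
nothing else about λ₁, λ₂, ν.

Cokernel. The exponent max(a(h_α), b(h_α)) of V(a, b) agrees with the exponent s_α of D(2, a + b)
unless α has L-value 2, in which case the latter is smaller by one. The power relations of D(2, a +
b) then follow from the vanishing of x_α⁻ ⊗ t^{s_α} and the Weyl relations. So D(2, a + b) is V(a,
b) modulo the vectors (x_γ⁻ ⊗ t^{a(h_γ) - 1}) v with γ of L-value 2. Such a γ arises from β by
adding at most two roots ε_i - ε_j of L-value 0, and bracketing with their root vectors reduces all
these relations to the single one for β (`smul_eq_zero_of_ev_two`, `satisfies_dRel`,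
`satisfies_vRel`).

The left map. It must be shown that (x_β⁻ ⊗ t^s) v satisfies the relations of V(a - β, b)
(`satisfies_smul`). It is a highest weight vector because a decomposition β = α + δ into positive
roots forces both summands to have L-value 1 (`ev_of_sum`). The relation for x_α⁻ is checked
according to the inner product of α and β (`bound_smul`).

The analytic input is a Garland-type identity for the loop algebra of sl₂, obtained from generating
series (`IsSl2LoopVector.coeff_pow_smul_eq_zero`): a highest weight vector of weight c is killed by
the coefficient of X^k in (∑ f_i X^i)^r whenever r + k > c. It needs every f_0 = x_α⁻ ⊗ 1 to act
nilpotently, whereas the presentation grants this for simple roots only; local nilpotency is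
therefore propagated to all roots. -/

/-! ### Highest weight vectors for the loop algebra of sl₂ -/

/-- The relations of the loop algebra of `sl₂` used below. -/
structure IsSl2Loop {A : Type*} [Ring A] (e h f : ℕ → A) : Prop where
  ef : ∀ r s, e r * f s = f s * e r + h (r + s)
  hf : ∀ r s, h r * f s = f s * h r - 2 * f (r + s)
  ff : ∀ r s, f r * f s = f s * f r

/-- A highest weight vector for the loop algebra of `sl₂`, of weight `c`, on which the positive
part of the Cartan subalgebra acts by zero, and which is killed by a power of `f 0`. -/
structure IsSl2LoopVector {A M : Type*} [Ring A] [AddCommGroup M] [Module A M]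
    (e h f : ℕ → A) (c : ℤ) (w : M) : Prop where
  raise : ∀ r, e r • w = 0
  weight : h 0 • w = c • w
  cartan : ∀ r, h (r + 1) • w = 0
  nilp : ∃ N, f 0 ^ N • w = 0

section RingIdentities

variable {A : Type*} [Ring A]

/-- Since G commutes with F, moving H past F^k costs 2k F^(k-1) G; summing over the factors of
F^(R+1) gives the formula. It is applied both to sl₂ itself (G = F) and to generating series. The
truncated exponent at R = 0 is harmless, as its coefficient vanishes. -/
theorem mul_pow_succ_of_sl2_like {E F H G : A} (h₁ : E * F = F * E + H)
    (h₂ : H * F = F * H - 2 * G) (h₃ : G * F = F * G) (R : ℕ) :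
    E * F ^ (R + 1) = F ^ (R + 1) * E + (R + 1 : ℕ) * (F ^ R * H) -
      ((R + 1) * R : ℕ) * (F ^ (R - 1) * G) := by
  have hG : ∀ k, G * F ^ k = F ^ k * G := fun k => (Commute.pow_right (show Commute G F from h₃) k)
  have hH : ∀ k : ℕ, H * F ^ k = F ^ k * H - (2 * k : ℕ) * (F ^ (k - 1) * G) := by
    intro k
    induction k with
    | zero => simp
    | succ k ih =>
      have e1 : H * F ^ (k + 1) = (F * H - 2 * G) * F ^ k := by rw [pow_succ', ← mul_assoc, h₂]
      rw [e1, sub_mul, mul_assoc, mul_assoc, ih, hG, mul_sub, ← mul_assoc, ← pow_succ',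
        Nat.add_sub_cancel]
      have e2 : F * (((2 * k : ℕ) : A) * (F ^ (k - 1) * G)) = (2 * k : ℕ) * (F ^ k * G) := by
        cases k with
        | zero => simp
        | succ k =>
          rw [← mul_assoc, ← (Nat.cast_commute (2 * (k + 1)) F).eq, mul_assoc, ← mul_assoc F,
            Nat.add_sub_cancel, ← pow_succ']
      rw [e2]
      push_cast
      noncomm_ring
  induction R with
  | zero => simp [h₁]
  | succ R ih =>
    have e1 : E * F ^ (R + 1 + 1) = F * (E * F ^ (R + 1)) + H * F ^ (R + 1) := by
      rw [pow_succ' F (R + 1), ← mul_assoc, h₁, add_mul, mul_assoc]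
    have e2 : F * (((R + 1) * R : ℕ) * (F ^ (R - 1) * G)) = ((R + 1) * R : ℕ) * (F ^ R * G) := by
      cases R with
      | zero => simp
      | succ R =>
        rw [← mul_assoc, ← (Nat.cast_commute _ F).eq, mul_assoc, ← mul_assoc F,
          Nat.add_sub_cancel, ← pow_succ']
    have e3 : F * ((R + 1 : ℕ) * (F ^ R * H)) = (R + 1 : ℕ) * (F ^ (R + 1) * H) := by
      rw [← mul_assoc, ← (Nat.cast_commute _ F).eq, mul_assoc, ← mul_assoc F, ← pow_succ']
    rw [e1, ih, mul_sub, mul_add, e2, e3, hH, ← mul_assoc, ← pow_succ', Nat.add_sub_cancel]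
    push_cast
    noncomm_ring

end RingIdentities

section

variable {A M : Type*} [Ring A] [AddCommGroup M] [Module A M]

theorem eq_zero_of_natCast_smul [Module ℂ M] {k : ℕ} (hk : k ≠ 0) {x : M}
    (hx : (k : A) • x = 0) : x = 0 := by
  rw [Nat.cast_smul_eq_nsmul, ← Nat.cast_smul_eq_nsmul ℂ, smul_eq_zero] at hx
  exact hx.resolve_left (by exact_mod_cast hk)

theorem eq_zero_of_zsmul [Module ℂ M] {k : ℤ} (hk : k ≠ 0) {x : M} (hx : k • x = 0) : x = 0 := by
  rw [← Int.cast_smul_eq_zsmul ℂ, smul_eq_zero] at hx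
  exact hx.resolve_left (by exact_mod_cast hk)

variable {e h f : ℕ → A} {c : ℤ} {w : M}

/-- If k + 1 is the least exponent that kills w, then applying e 0 gives (k + 1)(c - k) f_0^k w = 0,
so c = k. -/
theorem IsSl2LoopVector.pow_smul_eq_zero [Module ℂ M] (hA : IsSl2Loop e h f)
    (hw : IsSl2LoopVector e h f c w)
    {K : ℕ} (hK : c < K) : f 0 ^ K • w = 0 := by
  classical
  have hmin := fun m => Nat.find_min hw.nilp (m := m)
  have hN := Nat.find_spec hw.nilp
  have hle : ∀ K, Nat.find hw.nilp ≤ K → f 0 ^ K • w = 0 := fun K h => by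
    rw [← Nat.sub_add_cancel h, pow_add, mul_smul, hN, smul_zero]
  generalize Nat.find hw.nilp = N at *
  cases N with
  | zero => exact hle K (Nat.zero_le _)
  | succ k =>
    apply hle
    have hk := hmin k (Nat.lt_succ_self k)
    have := mul_pow_succ_of_sl2_like (hA.ef 0 0) (by simpa using hA.hf 0 0) rfl k
    have h2 := congrArg (· • w) this
    simp only [mul_smul, hN, smul_zero, sub_smul, add_smul, hw.raise, hw.weight, zero_add] at h2
    have h3 : (((k : ℤ) + 1) * (c - k)) • (f 0 ^ k • w) = 0 := by
      rw [h2]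
      have e1 : (((k + 1) * k : ℕ) : A) • f 0 ^ (k - 1) • f 0 • w =
          ((k + 1) * k : ℕ) • (f 0 ^ k • w) := by
        rw [Nat.cast_smul_eq_nsmul]
        cases k with
        | zero => simp
        | succ k => rw [Nat.add_sub_cancel, ← mul_smul (f 0 ^ k), ← pow_succ]
      rw [e1, Nat.cast_smul_eq_nsmul, smul_comm _ c, ← natCast_zsmul, ← natCast_zsmul, smul_smul,
        ← sub_smul]
      congr 1
      push_cast
      ring
    by_contra hcon
    exact hk (eq_zero_of_zsmul (mul_ne_zero (by omega) (by omega)) h3)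

/-! ### Garland-type identities from generating series -/

open PowerSeries

theorem coeff_mk_pow_zero (f : ℕ → A) (R : ℕ) : coeff 0 (PowerSeries.mk f ^ R) = f 0 ^ R := by
  induction R with
  | zero => simp
  | succ R ih => rw [pow_succ, pow_succ, coeff_mul]; simp [ih]

theorem commute_coeff_pow (hff : ∀ r s, f r * f s = f s * f r) (i R k : ℕ) :
    Commute (f i) (coeff k (PowerSeries.mk f ^ R)) := by
  induction R generalizing k with
  | zero =>
    rw [pow_zero, coeff_one]
    split_ifs
    · exact Commute.one_right _
    · exact Commute.zero_right _
  | succ R ih =>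
    rw [pow_succ, coeff_mul]
    refine Commute.sum_right _ _ _ fun p _ => (ih p.1).mul_right ?_
    rw [coeff_mk]
    exact hff _ _

/-- The operator `X d/dX` multiplies coefficients by their index. -/
theorem natCast_mul_coeff_pow (hff : ∀ r s, f r * f s = f s * f r) (R k : ℕ) :
    (k : A) * coeff k (PowerSeries.mk f ^ R) =
      (R : A) * coeff k (PowerSeries.mk f ^ (R - 1) * PowerSeries.mk fun i => (i : A) * f i) := by
  -- F commutes with X dF/dX because the f_i commute, which is what makes the power rule valid over
  -- a noncommutative ring.
  have hcomm : PowerSeries.mk f * (PowerSeries.mk fun i => (i : A) * f i) =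
      (PowerSeries.mk fun i => (i : A) * f i) * PowerSeries.mk f := by
    ext k
    rw [coeff_mul, coeff_mul, ← Finset.Nat.sum_antidiagonal_swap]
    refine Finset.sum_congr rfl fun p _ => ?_
    simp only [Prod.fst_swap, Prod.snd_swap, coeff_mk]
    rw [mul_assoc, hff p.1 p.2, ← mul_assoc, ← mul_assoc, (Nat.cast_commute p.1 (f p.2)).eq]
  induction R generalizing k with
  | zero =>
    rw [pow_zero, coeff_one]
    split_ifs with h <;> simp [h]
  | succ R ih =>
    have e1 : (k : A) * coeff k (PowerSeries.mk f ^ (R + 1)) =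
        coeff k (PowerSeries.mk f ^ R * PowerSeries.mk fun i => (i : A) * f i) +
        ∑ p ∈ Finset.HasAntidiagonal.antidiagonal k,
          (p.1 : A) * coeff p.1 (PowerSeries.mk f ^ R) * f p.2 := by
      rw [pow_succ, coeff_mul, coeff_mul, Finset.mul_sum, ← Finset.sum_add_distrib]
      refine Finset.sum_congr rfl fun p hp => ?_
      rw [Finset.HasAntidiagonal.mem_antidiagonal] at hp
      simp only [coeff_mk]
      rw [← hp, ← mul_assoc, ← mul_assoc, ← (Nat.cast_commute p.2 _).eq]
      push_cast
      noncomm_ring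
    have e2 : ∑ p ∈ Finset.HasAntidiagonal.antidiagonal k,
          (p.1 : A) * coeff p.1 (PowerSeries.mk f ^ R) * f p.2 =
        (R : A) * coeff k (PowerSeries.mk f ^ R * PowerSeries.mk fun i => (i : A) * f i) := by
      cases R with
      | zero =>
        rw [Nat.cast_zero, zero_mul]
        refine Finset.sum_eq_zero fun p _ => ?_
        rw [pow_zero, coeff_one]
        split_ifs with h0 <;> simp [h0]
      | succ R =>
        have e3 : PowerSeries.mk f ^ (R + 1) * (PowerSeries.mk fun i => (i : A) * f i) =
            PowerSeries.mk f ^ R * (PowerSeries.mk fun i => (i : A) * f i) * PowerSeries.mk f := by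
          rw [pow_succ, mul_assoc, hcomm, mul_assoc]
        rw [e3, coeff_mul, Finset.mul_sum]
        refine Finset.sum_congr rfl fun p _ => ?_
        rw [ih, coeff_mk, Nat.add_sub_cancel, mul_assoc]
    rw [e1, e2, Nat.add_sub_cancel]
    push_cast
    noncomm_ring

/-- This is `mul_pow_succ_of_sl2_like` over the power series ring, with E = e_1 X, F = ∑ f_i X^i and
G = X dF/dX, read off at the coefficient of X^(k+1) and applied to w. -/
theorem IsSl2LoopVector.smul_coeff_pow (hA : IsSl2Loop e h f) (hw : IsSl2LoopVector e h f c w)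
    (R k : ℕ) : e 1 • coeff k (PowerSeries.mk f ^ (R + 1)) • w =
      -(((R + 1) * (k + 1) : ℕ) : A) • coeff (k + 1) (PowerSeries.mk f ^ R) • w := by
  -- The bracket of e_1 X with F involves only h_i with i ≥ 1, all of which kill w; hence the
  -- constant term is set to zero.
  let H : PowerSeries A := PowerSeries.mk fun i => if i = 0 then 0 else h i
  let E : PowerSeries A := X * C (e 1)
  have hE : ∀ (G : PowerSeries A) (k : ℕ), coeff (k + 1) (E * G) = e 1 * coeff k G := by
    intro G k
    rw [show E * G = X * (C (e 1) * G) from mul_assoc _ _ _, coeff_succ_X_mul, coeff_C_mul]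
  have hE0 : ∀ (G : PowerSeries A), coeff 0 (E * G) = 0 := by
    intro G
    rw [show E * G = X * (C (e 1) * G) from mul_assoc _ _ _, coeff_zero_X_mul]
  have hE' : ∀ (G : PowerSeries A) (k : ℕ), coeff (k + 1) (G * E) = coeff k G * e 1 := by
    intro G k
    rw [show G * E = X * (G * C (e 1)) by
      rw [← mul_assoc, ← (X_mul (φ := G)), mul_assoc], coeff_succ_X_mul, coeff_mul_C]
  have hE0' : ∀ (G : PowerSeries A), coeff 0 (G * E) = 0 := by
    intro G
    rw [show G * E = X * (G * C (e 1)) by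
      rw [← mul_assoc, ← (X_mul (φ := G)), mul_assoc], coeff_zero_X_mul]
  have h₁ : E * PowerSeries.mk f = PowerSeries.mk f * E + H := by
    ext k
    cases k with
    | zero => rw [map_add, hE0, hE0']; simp [H]
    | succ k =>
      rw [map_add, hE, hE', coeff_mk, hA.ef]
      simp [H, add_comm]
  have h₂ : H * PowerSeries.mk f =
      PowerSeries.mk f * H - 2 * (PowerSeries.mk fun i => (i : A) * f i) := by
    ext k
    have e1 : coeff k (2 * (PowerSeries.mk fun i => (i : A) * f i) : PowerSeries A) =
        2 * ((k : A) * f k) := by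
      rw [two_mul, map_add, coeff_mk, two_mul]
    rw [map_sub, e1, coeff_mul, coeff_mul, ← Finset.Nat.sum_antidiagonal_swap,
      eq_sub_iff_add_eq]
    simp only [Prod.fst_swap, Prod.snd_swap, coeff_mk, H]
    have e2 : (2 : A) * (k * f k) =
        ∑ p ∈ Finset.HasAntidiagonal.antidiagonal k, (if p.2 = 0 then 0 else 2 * f k) := by
      rw [Finset.Nat.sum_antidiagonal_eq_sum_range_succ (fun _ j => if j = 0 then 0 else 2 * f k),
        Finset.sum_range_succ]
      simp only [Nat.sub_self, if_true, add_zero]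
      rw [Finset.sum_congr rfl (g := fun _ => 2 * f k)
        (fun i hi => if_neg (by rw [Finset.mem_range] at hi; omega))]
      rw [Finset.sum_const, Finset.card_range, nsmul_eq_mul, ← mul_assoc, ← mul_assoc,
        (Nat.cast_commute k (2 : A)).eq]
    rw [e2, ← Finset.sum_add_distrib]
    refine Finset.sum_congr rfl fun p hp => ?_
    rw [Finset.HasAntidiagonal.mem_antidiagonal] at hp
    split_ifs with h0
    · simp
    · rw [hA.hf, ← hp, add_comm p.2]; noncomm_ring
  have h₃ : (PowerSeries.mk fun i => (i : A) * f i) * PowerSeries.mk f =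
      PowerSeries.mk f * (PowerSeries.mk fun i => (i : A) * f i) := by
    ext k
    rw [coeff_mul, coeff_mul, ← Finset.Nat.sum_antidiagonal_swap]
    refine Finset.sum_congr rfl fun p _ => ?_
    simp only [Prod.fst_swap, Prod.snd_swap, coeff_mk]
    rw [mul_assoc, hA.ff, ← mul_assoc, ← mul_assoc, (Nat.cast_commute p.2 (f p.1)).eq]
  have key := congrArg (fun G => coeff (k + 1) G • w) (mul_pow_succ_of_sl2_like h₁ h₂ h₃ R)
  simp only [hE, map_sub, map_add, hE', add_smul, sub_smul, mul_smul, hw.raise, smul_zero,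
    zero_add] at key
  have hcast : ∀ (m : ℕ) (G : PowerSeries A), coeff (k + 1) ((m : PowerSeries A) * G) =
      (m : A) * coeff (k + 1) G := by
    intro m G
    rw [← map_natCast (C (R := A)) m, coeff_C_mul]
  have hH : coeff (k + 1) (PowerSeries.mk f ^ R * H) • w = 0 := by
    rw [coeff_mul, Finset.sum_smul]
    refine Finset.sum_eq_zero fun p _ => ?_
    rw [mul_smul]
    simp only [H, coeff_mk]
    split_ifs with h0
    · simp
    · rw [← Nat.sub_add_cancel (Nat.pos_of_ne_zero h0), hw.cartan, smul_zero]
  -- The surviving term R F^(R-1) G is X d/dX of F^R, which yields the factor k + 1.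
  have hθ := natCast_mul_coeff_pow hA.ff R (k + 1)
  rw [key, hcast, hcast, mul_smul, hH, smul_zero, zero_sub, neg_smul, Nat.cast_mul, mul_assoc, ← hθ,
    ← mul_assoc, ← Nat.cast_mul, mul_smul]

/-- Induction on k: up to a nonzero scalar, e_1 trades one factor of F for one more degree in X, so
r + k is preserved. The base case is f_0^r w = 0. -/
theorem IsSl2LoopVector.coeff_pow_smul_eq_zero [Module ℂ M] (hA : IsSl2Loop e h f)
    (hw : IsSl2LoopVector e h f c w) {r k : ℕ} (hrk : c < (r + k : ℕ)) :
    coeff k (PowerSeries.mk f ^ r) • w = 0 := by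
  induction k generalizing r with
  | zero => rw [coeff_mk_pow_zero]; exact hw.pow_smul_eq_zero hA hrk
  | succ k ih =>
    have h1 := hw.smul_coeff_pow hA r k
    rw [ih (r := r + 1) (by rw [show r + 1 + k = r + (k + 1) by ring]; exact hrk), smul_zero,
      neg_smul, eq_comm, neg_eq_zero] at h1
    exact eq_zero_of_natCast_smul (by positivity) h1

/-- On w the series F behaves like a polynomial of degree p, since commutativity lets any f_i with i
> p act first; thus F^r has degree at most rp and leading coefficient f_p^r. -/
theorem coeff_pow_smul_of_le (hff : ∀ r s, f r * f s = f s * f r) {p : ℕ}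
    (hp : ∀ i, p < i → f i • w = 0) (r : ℕ) :
    (∀ k, r * p < k → coeff k (PowerSeries.mk f ^ r) • w = 0) ∧
      coeff (r * p) (PowerSeries.mk f ^ r) • w = f p ^ r • w := by
  induction r with
  | zero =>
    constructor
    · intro k hk
      rw [pow_zero, coeff_one, if_neg (by omega), zero_smul]
    · simp
  | succ r ih =>
    have hz : ∀ i j, p < i → (f i * coeff j (PowerSeries.mk f ^ r)) • w = 0 := fun i j hi => by
      rw [(commute_coeff_pow hff i r j).eq, mul_smul, hp i hi, smul_zero]
    constructor
    · intro k hk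
      rw [pow_succ', coeff_mul, Finset.sum_smul]
      refine Finset.sum_eq_zero fun q hq => ?_
      rw [Finset.HasAntidiagonal.mem_antidiagonal] at hq
      rw [coeff_mk]
      by_cases hq1 : p < q.1
      · exact hz _ _ hq1
      · rw [mul_smul, ih.1 q.2 (by rw [add_mul] at hk; omega), smul_zero]
    · rw [pow_succ', coeff_mul, Finset.sum_smul,
        Finset.sum_eq_single_of_mem (p, r * p) (by rw [Finset.HasAntidiagonal.mem_antidiagonal]; ring)]
      · rw [coeff_mk, mul_smul, ih.2, pow_succ', mul_smul]
      · intro q hq hne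
        rw [Finset.HasAntidiagonal.mem_antidiagonal, add_mul, one_mul] at hq
        rw [coeff_mk]
        by_cases hq1 : p < q.1
        · exact hz _ _ hq1
        · by_cases hq2 : q.1 = p
          · exact absurd (Prod.ext hq2 (show q.2 = r * p by omega)) hne
          · rw [mul_smul, ih.1 q.2 (by omega), smul_zero]

theorem IsSl2LoopVector.top_pow_smul [Module ℂ M] (hA : IsSl2Loop e h f)
    (hw : IsSl2LoopVector e h f c w)
    {p r : ℕ} (hp : ∀ i, p < i → f i • w = 0) (hr : c < (r * (p + 1) : ℕ)) :
    f p ^ r • w = 0 := by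
  rw [← (coeff_pow_smul_of_le hA.ff hp r).2]
  refine hw.coeff_pow_smul_eq_zero hA ?_
  rw [mul_add, mul_one, add_comm] at hr
  exact hr

/-- The coefficient of X^(2p+1) in F² acts on w as 2 f_p f_(p+1): every other pair of indices with
this sum contains one exceeding p + 1. -/
theorem IsSl2LoopVector.top_mul_smul [Module ℂ M] (hA : IsSl2Loop e h f)
    (hw : IsSl2LoopVector e h f c w)
    {p : ℕ} (hp : ∀ i, p + 1 < i → f i • w = 0) (hr : c < (2 * p + 3 : ℕ)) :
    f p • f (p + 1) • w = 0 := by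
  have h1 := hw.coeff_pow_smul_eq_zero hA (r := 2) (k := 2 * p + 1) (by rw [add_comm]; exact hr)
  have hz : ∀ i j, p + 1 < i → f j • f i • w = 0 := fun i j hi => by rw [hp i hi, smul_zero]
  have hc : ∀ i j, f i • f j • w = f j • f i • w := fun i j => by
    rw [← mul_smul, hA.ff, mul_smul]
  have hne : ((p, p + 1) : ℕ × ℕ) ≠ (p + 1, p) := by simp
  rw [pow_two, coeff_mul, Finset.sum_smul, ← Finset.sum_subset
    (s₁ := ({(p, p + 1), (p + 1, p)} : Finset (ℕ × ℕ))), Finset.sum_pair hne] at h1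
  · simp only [coeff_mk, mul_smul] at h1
    rw [hc (p + 1) p, ← two_nsmul, ← Nat.cast_smul_eq_nsmul A] at h1
    exact eq_zero_of_natCast_smul two_ne_zero h1
  · intro q hq
    simp only [Finset.mem_insert, Finset.mem_singleton] at hq
    rw [Finset.HasAntidiagonal.mem_antidiagonal]
    rcases hq with rfl | rfl <;> simp <;> omega
  · rintro ⟨i, j⟩ hq hq'
    rw [Finset.HasAntidiagonal.mem_antidiagonal] at hq
    simp only [Finset.mem_insert, Finset.mem_singleton, Prod.mk.injEq, not_or] at hq hq'
    simp only [coeff_mk, mul_smul]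
    by_cases hj : p + 1 < j
    · exact hz j i hj
    · rw [hc]; exact hz i j (by omega)

end

/-! ### Locally nilpotent elements -/

/-- Every vector of `M` is killed by a power of `x`. -/
def IsLocNilp {A : Type*} [Ring A] (x : A) (M : Type*) [AddCommGroup M] [Module A M] : Prop :=
  ∀ v : M, ∃ N, x ^ N • v = 0

section

variable {A M : Type*} [Ring A] [AddCommGroup M] [Module A M]

theorem pow_smul_eq_zero_of_le {x : A} {v : M} {N K : ℕ} (h : x ^ N • v = 0) (hNK : N ≤ K) :
    x ^ K • v = 0 := by
  rw [← Nat.sub_add_cancel hNK, pow_add, mul_smul, h, smul_zero]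

/-- If `x` and `y` are locally nilpotent and commute with `z = [x, y]`, then so is `z`. -/
theorem IsLocNilp.of_heisenberg [Module ℂ M] {x y z : A} (hx : IsLocNilp x M) (hy : IsLocNilp y M)
    (hxy : x * y = y * x + z) (hxz : x * z = z * x) (hyz : y * z = z * y) : IsLocNilp z M := by
  have hzp : ∀ k, x * z ^ k = z ^ k * x := fun k => Commute.pow_right (show Commute x z from hxz) k
  have hxyp : ∀ K : ℕ, x * y ^ (K + 1) = y ^ (K + 1) * x + (K + 1 : ℕ) * (y ^ K * z) := by
    intro K
    induction K with
    | zero => simpa using hxy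
    | succ K ih =>
      rw [pow_succ y (K + 1), ← mul_assoc, ih, add_mul, mul_assoc, hxy]
      have : ((K + 1 : ℕ) : A) * (y ^ K * z) * y = (K + 1 : ℕ) * (y ^ (K + 1) * z) := by
        rw [mul_assoc, mul_assoc, ← hyz, ← mul_assoc (y ^ K), ← pow_succ]
      rw [this]
      push_cast
      noncomm_ring
  -- On vectors killed by x, the identity x y^(K+1) v = (K + 1) y^K z v converts nilpotency of y
  -- into nilpotency of z. The general case first multiplies v by a power of z to reach the kernel
  -- of x.
  have h0 : ∀ (K : ℕ) (v : M), x • v = 0 → y ^ K • v = 0 → z ^ K • v = 0 := by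
    intro K
    induction K with
    | zero => intro v _ h; simpa using h
    | succ K ih =>
      intro v hv h
      rw [pow_succ, mul_smul]
      apply ih
      · rw [← mul_smul, hxz, mul_smul, hv, smul_zero]
      · have := congrArg (· • v) (hxyp K)
        simp only [mul_smul, add_smul, h, hv, smul_zero, zero_add] at this
        exact eq_zero_of_natCast_smul (Nat.succ_ne_zero K) this.symm
  intro v
  obtain ⟨N, hN⟩ := hx v
  induction N generalizing v with
  | zero => exact ⟨0, by simpa using hN⟩
  | succ N ih =>
    obtain ⟨k, hk⟩ := ih (x • v) (by rwa [← mul_smul, ← pow_succ])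
    obtain ⟨K, hK⟩ := hy (z ^ k • v)
    refine ⟨K + k, ?_⟩
    rw [pow_add, mul_smul]
    apply h0 K _ _ hK
    rw [← mul_smul, hzp, mul_smul, hk]

/-- The operator `y` maps vectors killed by a power of `f` to such vectors. -/
def PreservesNil (f y : A) (M : Type*) [AddCommGroup M] [Module A M] : Prop :=
  ∀ v : M, (∃ N, f ^ N • v = 0) → ∃ N, f ^ N • y • v = 0

/-- Moving one f past y either shortens the power of f needed on v or replaces y by the commutator
z. Iterating this handles any y with (ad f)^m y = 0 for some m. -/
theorem PreservesNil.of_commutator {f y z : A} (h : f * y = y * f + z)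
    (hz : PreservesNil f z M) : PreservesNil f y M := by
  rintro v ⟨N, hN⟩
  induction N generalizing v with
  | zero => exact ⟨0, by rw [pow_zero, one_smul] at hN; rw [hN, smul_zero, smul_zero]⟩
  | succ N ih =>
    obtain ⟨K₁, hK₁⟩ := ih (f • v) (by rwa [← mul_smul, ← pow_succ])
    obtain ⟨K₂, hK₂⟩ := hz v ⟨_, hN⟩
    refine ⟨max K₁ K₂ + 1, ?_⟩
    rw [pow_succ, mul_smul, ← mul_smul f, h, add_smul, smul_add, mul_smul,
      pow_smul_eq_zero_of_le hK₁ (le_max_left _ _), pow_smul_eq_zero_of_le hK₂ (le_max_right _ _),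
      add_zero]

theorem PreservesNil.zero (f : A) : PreservesNil f 0 M := fun v _ => ⟨0, by simp⟩

theorem PreservesNil.one (f : A) : PreservesNil f 1 M := fun v h => by simpa using h

theorem PreservesNil.mul {f y z : A} (hy : PreservesNil f y M) (hz : PreservesNil f z M) :
    PreservesNil f (y * z) M := fun v h => by rw [mul_smul]; exact hy _ (hz _ h)

theorem PreservesNil.add {f y z : A} (hy : PreservesNil f y M) (hz : PreservesNil f z M) :
    PreservesNil f (y + z) M := fun v h => by
  obtain ⟨K₁, hK₁⟩ := hy v h
  obtain ⟨K₂, hK₂⟩ := hz v h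
  refine ⟨max K₁ K₂, ?_⟩
  rw [add_smul, smul_add, pow_smul_eq_zero_of_le hK₁ (le_max_left _ _),
    pow_smul_eq_zero_of_le hK₂ (le_max_right _ _), add_zero]

end

namespace TypeD

attribute [local instance 100] LieRing.ofAssociativeRing

open PosRoot

variable {n : ℕ}

/-! ### Roots in orthogonal coordinates -/

/-- The value at a root of the linear form with coordinates `L`. -/
def PosRoot.ev (L : ℕ → ℤ) : PosRoot n → ℤ
  | sub i j _ => L i - L j
  | add i j _ => L i + L j

/-- The orthogonal coordinates of a root. -/
def PosRoot.vec : PosRoot n → ℕ → ℤ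
  | sub i j _, k => (if k = i then 1 else 0) - (if k = j then 1 else 0)
  | add i j _, k => (if k = i then 1 else 0) + (if k = j then 1 else 0)

theorem PosRoot.ev_vec_self (α : PosRoot n) : α.ev α.vec = 2 := by
  cases α with
  | sub i j h =>
    have : (i : ℕ) < j := h
    simp only [ev, vec]
    split_ifs <;> omega
  | add i j h =>
    have : (i : ℕ) < j := h
    simp only [ev, vec]
    split_ifs <;> omega

/-- Twice the orthogonal coordinates of a weight. -/
def twoCoord (lam : Weight n) (i : ℕ) : ℤ :=
  -- The two spin weights have coordinates ±1/2, which is why everything is doubled. For k = n - 2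
  -- the terms combine to 1 when i ≤ n - 2 and to -1 when i = n - 1.
  ∑ k : Fin n, lam k * ((if i ≤ k ∧ (k : ℕ) + 1 < n then 2 else 0) +
    (if (k : ℕ) + 1 = n then 1 else 0) - (if (k : ℕ) + 2 = n then 1 else 0))

theorem two_mul_pair (lam : Weight n) (α : PosRoot n) : 2 * pair lam α = α.ev (twoCoord lam) := by
  cases α with
  | sub i j h =>
    rw [ev, twoCoord, twoCoord, pair, ← Finset.sum_sub_distrib, Finset.mul_sum]
    refine Finset.sum_congr rfl fun k _ => ?_
    rw [← mul_sub]
    have hij : (i : ℕ) < j := h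
    have key : 2 * (((sub i j h).coeff k : ℕ) : ℤ) =
        ((if (i : ℕ) ≤ k ∧ (k : ℕ) + 1 < n then 2 else 0) + (if (k : ℕ) + 1 = n then 1 else 0) -
          (if (k : ℕ) + 2 = n then 1 else 0)) -
        ((if (j : ℕ) ≤ k ∧ (k : ℕ) + 1 < n then 2 else 0) + (if (k : ℕ) + 1 = n then 1 else 0) -
          (if (k : ℕ) + 2 = n then 1 else 0)) := by
      simp only [coeff, Fin.le_def, Fin.lt_def]
      split_ifs <;> omega
    linear_combination lam k * key
  | add i j h =>
    rw [ev, twoCoord, twoCoord, pair, ← Finset.sum_add_distrib, Finset.mul_sum]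
    refine Finset.sum_congr rfl fun k _ => ?_
    rw [← mul_add]
    have hij : (i : ℕ) < j := h
    have key : 2 * (((add i j h).coeff k : ℕ) : ℤ) =
        ((if (i : ℕ) ≤ k ∧ (k : ℕ) + 1 < n then 2 else 0) + (if (k : ℕ) + 1 = n then 1 else 0) -
          (if (k : ℕ) + 2 = n then 1 else 0)) +
        ((if (j : ℕ) ≤ k ∧ (k : ℕ) + 1 < n then 2 else 0) + (if (k : ℕ) + 1 = n then 1 else 0) -
          (if (k : ℕ) + 2 = n then 1 else 0)) := by
      simp only [coeff, Fin.le_def]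
      split_ifs <;> omega
    linear_combination lam k * key

theorem pair_add_weight (lam mu : Weight n) (α : PosRoot n) :
    pair (lam + mu) α = pair lam α + pair mu α := by
  simp only [pair, Pi.add_apply, mul_add, Finset.sum_add_distrib]

theorem pair_sub_weight (lam mu : Weight n) (α : PosRoot n) :
    pair (lam - mu) α = pair lam α - pair mu α := by
  simp only [pair, Pi.sub_apply, mul_sub, Finset.sum_sub_distrib]

theorem pair_nonneg {lam : Weight n} (h : IsDominant lam) (α : PosRoot n) : 0 ≤ pair lam α :=
  Finset.sum_nonneg fun k _ => mul_nonneg (by positivity) (h k)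

theorem sum_ite_val_eq (c : Fin n → ℤ) (m : ℕ) :
    (∑ k : Fin n, if (k : ℕ) = m then c k else 0) = ext0 c m := by
  unfold ext0
  split_ifs with h
  · rw [Finset.sum_eq_single ⟨m, h⟩]
    · simp
    · intro b _ hb
      rw [if_neg fun hbm => hb (Fin.ext hbm)]
    · simp
  · exact Finset.sum_eq_zero fun k _ => if_neg fun (hk : (k : ℕ) = m) => h (by omega)

theorem twoCoord_sub_succ (lam : Weight n) {i : ℕ} (hi : i + 1 < n) :
    twoCoord lam i - twoCoord lam (i + 1) = 2 * ext0 lam i := by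
  rw [twoCoord, twoCoord, ← Finset.sum_sub_distrib, ← sum_ite_val_eq, Finset.mul_sum]
  refine Finset.sum_congr rfl fun k _ => ?_
  rw [← mul_sub]
  split_ifs <;> omega

theorem twoCoord_last (lam : Weight n) (hn : 2 ≤ n) :
    twoCoord lam (n - 1) = ext0 lam (n - 1) - ext0 lam (n - 2) := by
  rw [twoCoord, ← sum_ite_val_eq, ← sum_ite_val_eq, ← Finset.sum_sub_distrib]
  refine Finset.sum_congr rfl fun k _ => ?_
  split_ifs <;> omega

/-- The recursion determining the coordinates of a weight. -/
theorem twoCoord_unique (lam : Weight n) (hn : 2 ≤ n) {L : ℕ → ℤ}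
    (h₁ : ∀ i, i + 1 < n → L i - L (i + 1) = 2 * ext0 lam i)
    (h₂ : L (n - 2) + L (n - 1) = 2 * ext0 lam (n - 1)) {i : ℕ} (hi : i < n) :
    twoCoord lam i = L i := by
  obtain ⟨m, hm⟩ : ∃ m, i + m = n - 1 := ⟨n - 1 - i, by omega⟩
  induction m generalizing i with
  | zero =>
    obtain rfl : i = n - 1 := by omega
    have := h₁ (n - 2) (by omega)
    rw [show n - 2 + 1 = n - 1 by omega] at this
    rw [twoCoord_last _ hn]
    omega
  | succ m ih =>
    have e1 := ih (i := i + 1) (by omega) (by omega)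
    have e2 := h₁ i (by omega)
    have e3 := twoCoord_sub_succ lam (i := i) (by omega)
    omega

theorem cartanMatrix_D_apply (hn : 3 ≤ n) (i k : Fin n) : CartanMatrix.D n i k =
    2 * (if (k : ℕ) = i then 1 else 0) - (if (k : ℕ) = i + 1 ∧ (i : ℕ) + 2 < n then 1 else 0) -
    (if (k : ℕ) + 1 = i ∧ (i : ℕ) + 1 < n then 1 else 0) -
    (if (k : ℕ) = n - 1 ∧ (i : ℕ) + 3 = n then 1 else 0) -
    (if (k : ℕ) = n - 3 ∧ (i : ℕ) + 1 = n then 1 else 0) := by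
  simp only [CartanMatrix.D, Matrix.of_apply, Fin.ext_iff]
  split_ifs <;> omega

/-- The coefficients of a root, with natural number indices. -/
def PosRoot.coeffN : PosRoot n → ℕ → ℤ
  | sub i j _, k => if (i : ℕ) ≤ k ∧ k < j then 1 else 0
  | add i j _, k => (if (i : ℕ) ≤ k ∧ k + 2 < n then 1 else 0) +
      (if k + 1 = n then 1 else 0) + (if (j : ℕ) ≤ k ∧ k + 1 < n then 1 else 0)

theorem ext0_coeff (α : PosRoot n) {m : ℕ} (hm : m < n) :
    ext0 (fun k => (α.coeff k : ℤ)) m = α.coeffN m := by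
  rw [ext0, dif_pos hm]
  cases α <;> simp only [coeff, coeffN, Fin.le_def, Fin.lt_def] <;> push_cast <;> rfl

theorem rootWeight_eq (hn : 3 ≤ n) (α : PosRoot n) (i : Fin n) : rootWeight α i =
    2 * α.coeffN i - (if (i : ℕ) + 2 < n then α.coeffN (i + 1) else 0) -
    (if 1 ≤ (i : ℕ) ∧ (i : ℕ) + 1 < n then α.coeffN (i - 1) else 0) -
    (if (i : ℕ) + 3 = n then α.coeffN (n - 1) else 0) -
    (if (i : ℕ) + 1 = n then α.coeffN (n - 3) else 0) := by
  have e : ∀ (m : ℕ) (hm : m < n) (p : Prop) [Decidable p],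
      (∑ k : Fin n, (if (k : ℕ) = m ∧ p then 1 else 0) * (α.coeff k : ℤ)) =
        if p then α.coeffN m else 0 := by
    intro m hm p _
    split_ifs with hp
    · rw [← ext0_coeff α hm, ← sum_ite_val_eq]
      refine Finset.sum_congr rfl fun k _ => ?_
      simp [hp]
    · exact Finset.sum_eq_zero fun k _ => by simp [hp]
  have e1 := e i i.2 True
  have e2 : (∑ k : Fin n, (if (k : ℕ) = i + 1 ∧ (i : ℕ) + 2 < n then 1 else 0) *
      (α.coeff k : ℤ)) = if (i : ℕ) + 2 < n then α.coeffN (i + 1) else 0 := by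
    by_cases hi : (i : ℕ) + 2 < n
    · exact e (i + 1) (by omega) _
    · simp [hi]
  have e3 : (∑ k : Fin n, (if (k : ℕ) + 1 = i ∧ (i : ℕ) + 1 < n then 1 else 0) *
      (α.coeff k : ℤ)) = if 1 ≤ (i : ℕ) ∧ (i : ℕ) + 1 < n then α.coeffN (i - 1) else 0 := by
    rw [← e (i - 1) (by omega)]
    refine Finset.sum_congr rfl fun k _ => ?_
    congr 1
    split_ifs <;> omega
  have e4 := e (n - 1) (by omega) ((i : ℕ) + 3 = n)
  have e5 := e (n - 3) (by omega) ((i : ℕ) + 1 = n)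
  simp only [and_true, if_true] at e1
  rw [rootWeight, ← e1, ← e2, ← e3, ← e4, ← e5, Finset.mul_sum, ← Finset.sum_sub_distrib,
    ← Finset.sum_sub_distrib, ← Finset.sum_sub_distrib, ← Finset.sum_sub_distrib]
  refine Finset.sum_congr rfl fun k _ => ?_
  rw [cartanMatrix_D_apply hn]
  ring

/-- Coordinate m of ∑ c_k α_k is c_m - c_(m-1), because α_k = ε_k - ε_(k+1); the last simple root
ε_(n-2) + ε_(n-1) contributes the extra term at m = n - 2. -/
theorem PosRoot.vec_eq (α : PosRoot n) (m : ℕ) (hm : m < n) : α.vec m = α.coeffN m -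
    (if 1 ≤ m then α.coeffN (m - 1) else 0) + (if m + 2 = n then α.coeffN (n - 1) else 0) := by
  cases α with
  | sub i j h =>
    have : (i : ℕ) < j := h
    simp only [vec, coeffN]
    split_ifs <;> omega
  | add i j h =>
    have hij : (i : ℕ) < j := h
    have c1 : ∀ k, k + 2 < n → (add i j h).coeffN k =
        (if (i : ℕ) ≤ k then 1 else 0) + (if (j : ℕ) ≤ k then 1 else 0) := by
      intro k hk
      simp only [coeffN]
      split_ifs <;> omega
    have c2 : ∀ k, k + 2 = n → (add i j h).coeffN k = if (j : ℕ) ≤ k then 1 else 0 := by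
      intro k hk
      simp only [coeffN]
      split_ifs <;> omega
    have c3 : (add i j h).coeffN (n - 1) = 1 := by
      simp only [coeffN]
      split_ifs <;> omega
    rw [c3, vec]
    obtain h | h | rfl : m + 2 < n ∨ m + 2 = n ∨ m = n - 1 := by omega
    · rw [c1 m h, c1 (m - 1) (by omega)]
      split_ifs <;> omega
    · rw [c2 m h]
      by_cases hm1 : 1 ≤ m
      · rw [c1 (m - 1) (by omega)]
        split_ifs <;> omega
      · split_ifs <;> omega
    · rw [c3, c2 (n - 1 - 1) (by omega)]
      split_ifs <;> omega

theorem ext0_rootWeight (hn : 3 ≤ n) (α : PosRoot n) :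
    (∀ i, i + 1 < n → α.vec i - α.vec (i + 1) = ext0 (rootWeight α) i) ∧
      α.vec (n - 2) + α.vec (n - 1) = ext0 (rootWeight α) (n - 1) := by
  have hr : ∀ i (hi : i < n), ext0 (rootWeight α) i = rootWeight α ⟨i, hi⟩ := fun i hi => by
    rw [ext0, dif_pos hi]
  constructor
  · intro i hi
    rw [hr i (by omega), rootWeight_eq hn, α.vec_eq i (by omega), α.vec_eq (i + 1) hi]
    obtain h | h | h : i + 3 < n ∨ i + 3 = n ∨ i + 2 = n := by omega
    · simp only [Nat.add_sub_cancel]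
      split_ifs <;> omega
    · simp only [Nat.add_sub_cancel]
      split_ifs <;> omega
    · obtain rfl : i = n - 2 := by omega
      have e1 : n - 2 + 1 = n - 1 := by omega
      have e2 : n - 1 - 1 = n - 2 := by omega
      simp only [e1, e2]
      split_ifs <;> omega
  · rw [hr (n - 1) (by omega), rootWeight_eq hn, α.vec_eq (n - 2) (by omega),
      α.vec_eq (n - 1) (by omega)]
    have e2 : n - 1 - 1 = n - 2 := by omega
    have e3 : n - 2 - 1 = n - 3 := by omega
    simp only [e2, e3]
    split_ifs <;> omega

theorem twoCoord_rootWeight (hn : 3 ≤ n) (α : PosRoot n) {i : ℕ} (hi : i < n) :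
    twoCoord (rootWeight α) i = 2 * α.vec i := by
  obtain ⟨h1, h2⟩ := ext0_rootWeight hn α
  refine twoCoord_unique _ (by omega) (L := fun i => 2 * α.vec i) (fun i hi => ?_) ?_ hi
  · rw [← h1 i hi, mul_sub]
  · rw [← h2, mul_add]

/-- Identifies the pairing defined through the Cartan matrix with the Euclidean inner product, so
that later cases can be sorted by inner products. -/
theorem pair_rootWeight (hn : 3 ≤ n) (α β : PosRoot n) : pair (rootWeight β) α = α.ev β.vec := by
  have h := two_mul_pair (rootWeight β) α
  have : α.ev (twoCoord (rootWeight β)) = 2 * α.ev β.vec := by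
    cases α <;> simp only [ev, twoCoord_rootWeight hn β (Fin.is_lt _)] <;> ring
  omega

/-! ### Interlacing pairs in orthogonal coordinates -/

theorem twoCoord_eq_sum (lam : Weight n) (hn : 2 ≤ n) (m : ℕ) (hm : m + 2 ≤ n) :
    twoCoord lam (n - 2 - m) = 2 * (∑ k ∈ Finset.Ico (n - 2 - m) (n - 2), ext0 lam k) +
      (ext0 lam (n - 2) + ext0 lam (n - 1)) := by
  induction m with
  | zero =>
    have h1 := twoCoord_last lam hn
    have h2 := twoCoord_sub_succ lam (i := n - 2) (by omega)
    rw [show n - 2 + 1 = n - 1 by omega] at h2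
    simp only [Nat.sub_zero, Finset.Ico_self, Finset.sum_empty]
    omega
  | succ m ih =>
    have h1 := ih (by omega)
    have h2 := twoCoord_sub_succ lam (i := n - 2 - (m + 1)) (by omega)
    rw [Finset.sum_eq_sum_Ico_succ_bot (by omega)]
    rw [show n - 2 - (m + 1) + 1 = n - 2 - m by omega] at h2 ⊢
    omega

/-- If `β` is a root in `R(λ₁, λ₂)` with `(λ₁ - λ₂)(h_β) > 0`, then the orthogonal coordinates of
`λ₁ - λ₂` are `0` or `1`, and the last one is `0`. -/
theorem exists_coord {lam₁ lam₂ : Weight n} (hn : 2 ≤ n) (h₁ : IsDominantOne lam₁)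
    (h₂ : IsDominantOne lam₂) (hint : IsInterlacing lam₁ lam₂) {β : PosRoot n}
    (hβ : β ∈ RSet lam₁ lam₂) (hlt : pair lam₂ β < pair lam₁ β) :
    ∃ L : ℕ → ℤ, (∀ i, L i = 0 ∨ L i = 1) ∧ L (n - 1) = 0 ∧
      ∀ α : PosRoot n, pair lam₁ α - pair lam₂ α = α.ev L := by
  obtain ⟨⟨i, j, h, hj, rfl⟩, hd⟩ := hβ
  have hij : (i : ℕ) < j := h
  have hd2 : pair (lam₁ - lam₂) (add i j h) = 2 := by
    have := pair_sub_weight lam₁ lam₂ (add i j h)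
    omega
  have hT := pair_add (lam₁ - lam₂) i j h hj
  have hfork := ext0_fork hn h₁ h₂ hint
  have hlast := twoCoord_last (lam₁ - lam₂) hn
  -- Twice a coordinate is twice a partial sum (0 or e) plus the fork sum (0, -e or -2e). The value
  -- 2 at β leaves only fork sum 0 with e = 1, or fork sum 2 with e = -1; both make every doubled
  -- coordinate 0 or 2. The two fork entries are equal in either case, so the last coordinate is 0.
  have hall : ∃ L : ℕ → ℤ, (∀ i, L i = 0 ∨ L i = 1) ∧ L (n - 1) = 0 ∧
      ∀ i < n, twoCoord (lam₁ - lam₂) i = 2 * L i := by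
    suffices hs : twoCoord (lam₁ - lam₂) (n - 1) = 0 ∧ ∀ i, i + 1 < n →
        twoCoord (lam₁ - lam₂) i = 0 ∨ twoCoord (lam₁ - lam₂) i = 2 by
      refine ⟨fun i => if i + 1 < n then twoCoord (lam₁ - lam₂) i / 2 else 0, fun i => ?_, ?_,
        fun i hi => ?_⟩
      · dsimp only
        split_ifs with hi
        · have := hs.2 i hi; omega
        · exact Or.inl rfl
      · dsimp only
        rw [if_neg (by omega)]
      · dsimp only
        split_ifs with hi'
        · have := hs.2 i hi'; omega
        · obtain rfl : i = n - 1 := by omega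
          rw [hs.1]; rfl
    rcases tail_sums hn h₁ h₂ hint (n - 2) (by omega) with h0 | ⟨e, he, hfe, hA, -⟩
    · have hz : ∀ j, ∑ k ∈ Finset.Ico j (n - 2), ext0 (lam₁ - lam₂) k = 0 := fun j =>
        Finset.sum_eq_zero fun k hk => h0 k (by omega)
      rw [hz, hz, h0 _ (by omega), h0 _ (by omega)] at hT
      omega
    · have hi' := hA i (by omega)
      have hj' := hA j (by omega)
      refine ⟨by omega, fun q hq => ?_⟩
      have hq' := hA q (by omega)
      have := twoCoord_eq_sum (lam₁ - lam₂) hn (n - 2 - q) (by omega)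
      rw [show n - 2 - (n - 2 - q) = q by omega] at this
      omega
  obtain ⟨L, hL, hL', hL2⟩ := hall
  refine ⟨L, hL, hL', fun α => ?_⟩
  have h1 := two_mul_pair (lam₁ - lam₂) α
  have h2 : α.ev (twoCoord (lam₁ - lam₂)) = 2 * α.ev L := by
    cases α <;> simp only [ev, hL2 _ (Fin.is_lt _)] <;> ring
  rw [← pair_sub_weight]
  omega

/-- Minimality of β turns into maximality of the positions p < q: a further position k > p with L k
= 1 would put ε_k + ε_q into R(λ₁, λ₂), and this root does not dominate β. -/
theorem IsBeta.exists_coord {lam₁ lam₂ : Weight n} (hn : 2 ≤ n) (h₁ : IsDominantOne lam₁)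
    (h₂ : IsDominantOne lam₂) (hint : IsInterlacing lam₁ lam₂) {β : PosRoot n}
    (hβ : IsBeta lam₁ lam₂ β) (hlt : pair lam₂ β < pair lam₁ β) :
    ∃ (p q : Fin n) (h : p < q) (L : ℕ → ℤ), β = add p q h ∧ (∀ i, L i = 0 ∨ L i = 1) ∧ L p = 1 ∧
      L q = 1 ∧ (∀ k < n, L k = 1 → k = q ∨ k ≤ p) ∧
      ∀ α : PosRoot n, pair lam₁ α - pair lam₂ α = α.ev L := by
  obtain ⟨L, hL, hL', hLd⟩ := TypeD.exists_coord hn h₁ h₂ hint hβ.1 hlt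
  obtain ⟨⟨p, q, h, hq, rfl⟩, hd⟩ := id hβ.1
  have hpq : (p : ℕ) < q := h
  have hLpq := hLd (add p q h)
  rw [← pair_sub_weight] at hLpq
  simp only [ev] at hLpq
  have hp1 := hL p
  have hq1 := hL q
  refine ⟨p, q, h, L, rfl, hL, by omega, by omega, ?_, hLd⟩
  intro k hk hk1
  by_contra! hcon
  have hkn : k + 1 < n := by
    by_contra hkn
    rw [show k = n - 1 by omega] at hk1
    omega
  have hmem : ∀ (i j : Fin n) (h : i < j), (j : ℕ) + 1 < n → L i = 1 → L j = 1 →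
      add i j h ∈ RSet lam₁ lam₂ := by
    intro i j h hj hi1 hj1
    refine ⟨⟨i, j, h, hj, rfl⟩, Or.inl ?_⟩
    rw [pair_sub_weight, hLd]
    simp only [ev]
    omega
  -- Every other element of R(λ₁, λ₂) has coefficients at least those of β, and α_p occurs in β.
  have hc : ∀ γ : PosRoot n, γ ∈ RSet lam₁ lam₂ → γ ≠ add p q h → γ.coeff p = 0 → False := by
    intro γ hγ hne h0
    have hp : 1 ≤ (add p q h).coeff p := by
      simp only [coeff, le_refl, true_and]
      rw [if_pos (by omega)]
      omega
    rcases hβ.2 γ hγ with h | ⟨δ, h⟩ | ⟨δ, ε, h⟩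
    · exact hne h
    · rw [h, Pi.add_apply] at h0
      omega
    · rw [h, Pi.add_apply, Pi.add_apply] at h0
      omega
  rcases lt_or_gt_of_ne hcon.1 with hkq | hkq
  · refine hc (add ⟨k, hk⟩ q hkq) (hmem _ _ _ hq hk1 (by omega)) ?_ ?_
    · intro heq
      have := congrArg (fun γ : PosRoot n => γ.vec k) heq
      simp only [vec] at this
      split_ifs at this <;> omega
    · simp only [coeff, Fin.le_def]
      split_ifs <;> omega
  · refine hc (add q ⟨k, hk⟩ hkq) (hmem _ _ _ hkn (by omega) hk1) ?_ ?_
    · intro heq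
      have := congrArg (fun γ : PosRoot n => γ.vec k) heq
      simp only [vec] at this
      split_ifs at this <;> omega
    · simp only [coeff, Fin.le_def]
      split_ifs <;> omega

/-! ### Root vectors -/

/-- The matrix `E_{a,b} - E_{b',a'}`, where `'` is the involution exchanging the two halves of the
index set. -/
def elt (a b : Fin n ⊕ Fin n) : Matrix (Fin n ⊕ Fin n) (Fin n ⊕ Fin n) ℂ :=
  Matrix.single a b 1 - Matrix.single b.swap a.swap 1

theorem elt_swap (a b : Fin n ⊕ Fin n) : elt b.swap a.swap = -elt a b := by
  simp [elt]

theorem elt_self_swap (a : Fin n ⊕ Fin n) : elt a a.swap = 0 := by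
  simp [elt]

theorem single_mul_single_ite (a b c d : Fin n ⊕ Fin n) :
    (Matrix.single a b 1 * Matrix.single c d 1 : Matrix _ _ ℂ) =
      if b = c then Matrix.single a d 1 else 0 := by
  split_ifs with h
  · subst h; simp
  · exact Matrix.single_mul_single_of_ne _ _ _ _ h _

/-- One formula covers all types of root vectors, so the later brackets reduce to comparing indices.
-/
theorem lie_elt (a b c d : Fin n ⊕ Fin n) : ⁅elt a b, elt c d⁆ =
    (if b = c then elt a d else 0) - (if a = d then elt c b else 0) -
      (if b = d.swap then elt a c.swap else 0) + (if a = c.swap then elt d.swap b else 0) := by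
  have hs : ∀ x y : Fin n ⊕ Fin n, x.swap = y ↔ x = y.swap := fun x y =>
    ⟨fun h => by rw [← h, Sum.swap_swap], fun h => by rw [h, Sum.swap_swap]⟩
  simp only [Ring.lie_def, elt, sub_mul, mul_sub, single_mul_single_ite, hs, Sum.swap_swap]
  simp only [@eq_comm _ d, @eq_comm _ c]
  simp only [hs]
  split_ifs <;> (try subst_vars) <;> simp_all <;> abel

theorem coe_xPlus_sub (i j : Fin n) (h : i < j) :
    (xPlus (sub i j h) : Matrix _ _ ℂ) = elt (.inl i) (.inl j) := by
  ext a b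
  rcases a with a | a <;> rcases b with b | b <;>
    simp [xPlus, elt, Matrix.single]

theorem coe_xPlus_add (i j : Fin n) (h : i < j) :
    (xPlus (add i j h) : Matrix _ _ ℂ) = elt (.inl i) (.inr j) := by
  ext a b
  rcases a with a | a <;> rcases b with b | b <;>
    simp [xPlus, elt, Matrix.single]

theorem coe_xMinus_sub (i j : Fin n) (h : i < j) :
    (xMinus (sub i j h) : Matrix _ _ ℂ) = elt (.inl j) (.inl i) := by
  ext a b
  rcases a with a | a <;> rcases b with b | b <;>
    simp [xMinus, elt, Matrix.single]

theorem coe_xMinus_add (i j : Fin n) (h : i < j) :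
    (xMinus (add i j h) : Matrix _ _ ℂ) = elt (.inr j) (.inl i) := by
  ext a b
  rcases a with a | a <;> rcases b with b | b <;>
    simp [xMinus, elt, Matrix.single]

theorem coe_coroot_sub (i j : Fin n) (h : i < j) :
    (coroot (sub i j h) : Matrix _ _ ℂ) = elt (.inl i) (.inl i) - elt (.inl j) (.inl j) := by
  ext a b
  rcases a with a | a <;> rcases b with b | b <;>
    simp [coroot, elt, Matrix.single]
  abel

theorem coe_coroot_add (i j : Fin n) (h : i < j) :
    (coroot (add i j h) : Matrix _ _ ℂ) = elt (.inl i) (.inl i) + elt (.inl j) (.inl j) := by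
  ext a b
  rcases a with a | a <;> rcases b with b | b <;>
    simp [coroot, elt, Matrix.single]
  abel

theorem elt_inl_inr_comm (i j : Fin n) : elt (.inl i) (.inr j) = -elt (.inl j) (.inr i) :=
  elt_swap (.inl j) (.inr i)

theorem elt_inr_inl_comm (i j : Fin n) : elt (.inr i) (.inl j) = -elt (.inr j) (.inl i) :=
  elt_swap (.inr j) (.inl i)

theorem elt_inr_inr (i j : Fin n) : elt (.inr i) (.inr j) = -elt (.inl j) (.inl i) :=
  elt_swap (.inl j) (.inl i)

theorem elt_inr_inl_self (i : Fin n) : elt (.inr i) (.inl i) = 0 := elt_self_swap (.inr i)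

theorem lie_elt_self (a : Fin n ⊕ Fin n) (c d : Fin n ⊕ Fin n) : ⁅elt a a, elt c d⁆ =
    (((if a = c then 1 else 0) - (if a = d then 1 else 0) + (if a = d.swap then 1 else 0) -
      (if a = c.swap then 1 else 0) : ℤ) : ℂ) • elt c d := by
  have h1 : (if a = d.swap then elt a c.swap else 0) = -(if a = d.swap then elt c d else 0) := by
    split_ifs with h
    · rw [h, elt_swap]
    · simp
  have h2 : (if a = c.swap then elt d.swap a else 0) = -(if a = c.swap then elt c d else 0) := by
    split_ifs with h
    · rw [h, elt_swap]
    · simp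
  have h3 : (if a = c then elt a d else 0) = if a = c then elt c d else 0 := by
    split_ifs with h
    · rw [h]
    · rfl
  have h4 : (if a = d then elt c a else 0) = if a = d then elt c d else 0 := by
    split_ifs with h
    · rw [h]
    · rfl
  rw [lie_elt, h1, h2, h3, h4]
  push_cast
  simp only [add_smul, sub_smul, ite_smul, one_smul, zero_smul]
  abel

theorem lie_coroot_xMinus (α γ : PosRoot n) :
    ⁅coroot α, xMinus γ⁆ = (-(α.ev γ.vec) : ℤ) • xMinus γ := by
  apply Subtype.ext
  rw [LieSubalgebra.coe_bracket, ← Int.cast_smul_eq_zsmul ℂ]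
  change ⁅(coroot α).1, (xMinus γ).1⁆ = ((-(α.ev γ.vec) : ℤ) : ℂ) • (xMinus γ).1
  cases α with
  | sub i j h =>
    cases γ with
    | sub k l h' =>
      rw [coe_coroot_sub, coe_xMinus_sub, sub_lie, lie_elt_self, lie_elt_self, ← sub_smul,
        ← Int.cast_sub]
      congr 2
      simp only [ev, vec, Sum.inl.injEq, Sum.swap_inl, reduceCtorEq, if_false, Fin.ext_iff]
      ring
    | add k l h' =>
      rw [coe_coroot_sub, coe_xMinus_add, sub_lie, lie_elt_self, lie_elt_self, ← sub_smul,
        ← Int.cast_sub]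
      congr 2
      simp only [ev, vec, Sum.inl.injEq, Sum.swap_inl, Sum.swap_inr, reduceCtorEq, if_false,
        Fin.ext_iff]
      ring
  | add i j h =>
    cases γ with
    | sub k l h' =>
      rw [coe_coroot_add, coe_xMinus_sub, add_lie, lie_elt_self, lie_elt_self, ← add_smul,
        ← Int.cast_add]
      congr 2
      simp only [ev, vec, Sum.inl.injEq, Sum.swap_inl, reduceCtorEq, if_false, Fin.ext_iff]
      ring
    | add k l h' =>
      rw [coe_coroot_add, coe_xMinus_add, add_lie, lie_elt_self, lie_elt_self, ← add_smul,
        ← Int.cast_add]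
      congr 2
      simp only [ev, vec, Sum.inl.injEq, Sum.swap_inl, Sum.swap_inr, reduceCtorEq, if_false,
        Fin.ext_iff]
      ring

theorem xMinus_mul_self (α : PosRoot n) : (xMinus α).1 * (xMinus α).1 = 0 := by
  cases α with
  | sub i j h =>
    rw [coe_xMinus_sub]
    simp [elt, sub_mul, mul_sub, h.ne, h.ne']
  | add i j h =>
    rw [coe_xMinus_add]
    simp [elt, sub_mul, mul_sub]

/-- Each term of (ad x)³ y contains the factor x², which vanishes in the defining representation. -/
theorem lie_lie_lie_xMinus (α : PosRoot n) (y : g n) :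
    ⁅xMinus α, ⁅xMinus α, ⁅xMinus α, y⁆⁆⁆ = 0 := by
  apply Subtype.ext
  simp only [LieSubalgebra.coe_bracket, Ring.lie_def, ZeroMemClass.coe_zero]
  have h := xMinus_mul_self α
  generalize (xMinus α).1 = x at *
  generalize y.1 = y at *
  have h3 : ∀ z, z * x * x = 0 := fun z => by rw [mul_assoc, h, mul_zero]
  simp only [mul_sub, sub_mul, ← mul_assoc, h, zero_mul, h3]
  simp

/-! ### Sums of roots and brackets of root vectors -/

/-- `γ` is the root `ε_u + ε_x`, where `u < x` or `x < u`. -/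
structure IsSumRoot (γ : PosRoot n) (u x : Fin n) : Prop where
  ev_eq : ∀ L, γ.ev L = L u + L x
  vec_eq : ∀ k, γ.vec k = (if k = u then 1 else 0) + (if k = x then 1 else 0)
  coe_xMinus : ∃ c : ℂ, c ≠ 0 ∧ (xMinus γ).1 = c • elt (.inr x) (.inl u)
  coe_xPlus : ∃ c : ℂ, (xPlus γ).1 = c • elt (.inl u) (.inr x)

theorem isSumRoot_add (i j : Fin n) (h : i < j) : IsSumRoot (add i j h) i j where
  ev_eq _ := rfl
  vec_eq _ := rfl
  coe_xMinus := ⟨1, one_ne_zero, by rw [coe_xMinus_add, one_smul]⟩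
  coe_xPlus := ⟨1, by rw [coe_xPlus_add, one_smul]⟩

/-- Exchanging the indices changes the sign of the root vector, and the scalar in `IsSumRoot`
absorbs it. Case distinctions can then start from a shared index regardless of the order. -/
theorem IsSumRoot.symm {γ : PosRoot n} {u x : Fin n} (h : IsSumRoot γ u x) : IsSumRoot γ x u where
  ev_eq L := by rw [h.ev_eq, add_comm]
  vec_eq k := by rw [h.vec_eq, add_comm]
  coe_xMinus := by
    obtain ⟨c, hc, e⟩ := h.coe_xMinus
    exact ⟨-c, neg_ne_zero.2 hc, by rw [e, elt_inr_inl_comm, smul_neg, neg_smul]⟩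
  coe_xPlus := by
    obtain ⟨c, e⟩ := h.coe_xPlus
    exact ⟨-c, by rw [e, elt_inl_inr_comm, smul_neg, neg_smul]⟩

theorem exists_isSumRoot {i j : Fin n} (h : i ≠ j) : ∃ δ : PosRoot n, IsSumRoot δ i j := by
  rcases lt_or_gt_of_ne h with h | h
  · exact ⟨_, isSumRoot_add i j h⟩
  · exact ⟨_, (isSumRoot_add j i h).symm⟩

/-- `β = α + δ`, witnessed by the root vectors. -/
structure IsRootSum (β α δ : PosRoot n) : Prop where
  ev_eq : ∀ L, β.ev L = α.ev L + δ.ev L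
  lie_eq : ∃ c : ℂ, c ≠ 0 ∧ ⁅xMinus δ, xMinus α⁆ = c • xMinus β
  lie_eq_zero : ⁅xMinus δ, xMinus β⁆ = 0

theorem lie_xMinus_isSumRoot {α β : PosRoot n} {i j p q : Fin n} (hα : IsSumRoot α i j)
    (hβ : IsSumRoot β p q) : ⁅xMinus α, xMinus β⁆ = 0 := by
  obtain ⟨c, -, e⟩ := hα.coe_xMinus
  obtain ⟨c', -, e'⟩ := hβ.coe_xMinus
  apply Subtype.ext
  rw [LieSubalgebra.coe_bracket, e, e', smul_lie, lie_smul, lie_elt]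
  simp

theorem lie_xMinus_sub_isSumRoot {β : PosRoot n} {i j p q : Fin n} (h : i < j)
    (hβ : IsSumRoot β p q) (hjp : j ≠ p) (hjq : j ≠ q) :
    ⁅xMinus (sub i j h), xMinus β⁆ = 0 := by
  obtain ⟨c', -, e'⟩ := hβ.coe_xMinus
  apply Subtype.ext
  rw [LieSubalgebra.coe_bracket, coe_xMinus_sub, e', lie_smul, lie_elt]
  simp [hjp, hjq]

theorem lie_xPlus_xMinus_sub {β : PosRoot n} {i j p q : Fin n} (h : i < j)
    (hβ : IsSumRoot β p q) (hip : i ≠ p) (hiq : i ≠ q) :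
    ⁅xPlus β, xMinus (sub i j h)⁆ = 0 := by
  obtain ⟨c', e'⟩ := hβ.coe_xPlus
  apply Subtype.ext
  rw [LieSubalgebra.coe_bracket, coe_xMinus_sub, e', smul_lie, lie_elt]
  simp [hip.symm, hiq.symm]

/-- `(ε_x + ε_u) = (ε_y + ε_u) + (ε_x - ε_y)`. -/
theorem isRootSum_sub {α β : PosRoot n} {u x y : Fin n} (h : x < y) (hyu : y ≠ u)
    (hα : IsSumRoot α u x) (hβ : IsSumRoot β u y) : IsRootSum α β (sub x y h) where
  ev_eq L := by rw [hα.ev_eq, hβ.ev_eq, ev]; ring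
  lie_eq := by
    obtain ⟨c, hc, e⟩ := hα.coe_xMinus
    obtain ⟨c', hc', e'⟩ := hβ.coe_xMinus
    refine ⟨-(c' * c⁻¹), neg_ne_zero.2 (mul_ne_zero hc' (inv_ne_zero hc)), ?_⟩
    apply Subtype.ext
    change ⁅(xMinus (sub x y h)).1, (xMinus β).1⁆ = (-(c' * c⁻¹)) • (xMinus α).1
    rw [coe_xMinus_sub, e', e, lie_smul, lie_elt, smul_smul, neg_mul, mul_assoc,
      inv_mul_cancel₀ hc, mul_one, elt_inr_inl_comm x u]
    simp [hyu]
  lie_eq_zero := lie_xMinus_sub_isSumRoot h hα hyu h.ne'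

/-- `(ε_i + ε_o) = (ε_i - ε_j) + (ε_j + ε_o)`. -/
theorem isRootSum_add {β δ : PosRoot n} {i j o : Fin n} (h : i < j) (hjo : j ≠ o)
    (hβ : IsSumRoot β i o) (hδ : IsSumRoot δ j o) : IsRootSum β (sub i j h) δ where
  ev_eq L := by rw [hβ.ev_eq, hδ.ev_eq, ev]; ring
  lie_eq := by
    obtain ⟨c, hc, e⟩ := hβ.coe_xMinus
    obtain ⟨c', hc', e'⟩ := hδ.coe_xMinus
    refine ⟨c' * c⁻¹, mul_ne_zero hc' (inv_ne_zero hc), ?_⟩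
    apply Subtype.ext
    change ⁅(xMinus δ).1, (xMinus (sub i j h)).1⁆ = (c' * c⁻¹) • (xMinus β).1
    rw [coe_xMinus_sub, e', e, smul_lie, lie_elt, smul_smul, mul_assoc, inv_mul_cancel₀ hc, mul_one]
    simp [hjo.symm]
  lie_eq_zero := lie_xMinus_isSumRoot hδ hβ

/-- The relative position of two negative root vectors, the second one belonging to a root
`ε_p + ε_q`. -/
theorem lie_xMinus_cases (α : PosRoot n) (p q : Fin n) (h : p < q) :
    α = add p q h ∨
    (α.ev (add p q h).vec = 0 ∧ ⁅xMinus α, xMinus (add p q h)⁆ = 0) ∨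
    (α.ev (add p q h).vec = -1 ∧ ∃ (δ : PosRoot n) (c : ℂ),
      ⁅xMinus α, xMinus (add p q h)⁆ = c • xMinus δ ∧
        ∀ L, δ.ev L = α.ev L + (add p q h).ev L) ∨
    (α.ev (add p q h).vec = 1 ∧ ⁅xMinus α, xMinus (add p q h)⁆ = 0 ∧
      ((∃ δ, IsRootSum (add p q h) α δ) ∨
        ∃ δ, IsRootSum α (add p q h) δ ∧ ⁅xPlus (add p q h), xMinus δ⁆ = 0 ∧
          (add p q h).ev δ.vec = -1)) := by
  have hpq : (p : ℕ) < q := h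
  have hβ := isSumRoot_add p q h
  cases α with
  | sub i j h' =>
    have hij : (i : ℕ) < j := h'
    -- With β = ε_u + ε_o and α = ε_i - ε_u, the sum α + β is the root ε_i + ε_o.
    have hsum : ∀ u o, IsSumRoot (add p q h) u o → j = u → i ≠ o → u ≠ o →
        ((sub i j h').ev (add p q h).vec = -1 ∧ ∃ (δ : PosRoot n) (c : ℂ),
          ⁅xMinus (sub i j h'), xMinus (add p q h)⁆ = c • xMinus δ ∧
          ∀ L, δ.ev L = (sub i j h').ev L + (add p q h).ev L) := by
      rintro u o hu rfl hio huo
      obtain ⟨δ, hδ⟩ := exists_isSumRoot hio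
      refine ⟨?_, ?_⟩
      · simp only [ev, hu.vec_eq]
        have := Fin.val_ne_of_ne hio
        have := Fin.val_ne_of_ne huo
        split_ifs <;> omega
      · obtain ⟨c, hc, e⟩ := hδ.coe_xMinus
        obtain ⟨c', hc', e'⟩ := hu.coe_xMinus
        refine ⟨δ, -(c' * c⁻¹), ?_, fun L => by rw [hδ.ev_eq, hu.ev_eq, ev]; ring⟩
        apply Subtype.ext
        change ⁅(xMinus (sub i j h')).1, (xMinus (add p q h)).1⁆ = (-(c' * c⁻¹)) • (xMinus δ).1
        rw [coe_xMinus_sub, e', e, lie_smul, lie_elt, smul_smul, neg_mul, mul_assoc,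
          inv_mul_cancel₀ hc, mul_one]
        simp [huo]
    -- With β = ε_u + ε_o and α = ε_u - ε_j, the complement is δ = ε_j + ε_o.
    have hdiff : ∀ u o, IsSumRoot (add p q h) u o → i = u → j ≠ o → u ≠ o →
        ((sub i j h').ev (add p q h).vec = 1 ∧
          ⁅xMinus (sub i j h'), xMinus (add p q h)⁆ = 0 ∧
          ∃ δ, IsRootSum (add p q h) (sub i j h') δ) := by
      rintro u o hu rfl hjo huo
      obtain ⟨δ, hδ⟩ := exists_isSumRoot hjo
      refine ⟨?_, lie_xMinus_sub_isSumRoot h' hu h'.ne' hjo, δ, isRootSum_add h' hjo hu hδ⟩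
      simp only [ev, hu.vec_eq]
      have := Fin.val_ne_of_ne hjo
      have := Fin.val_ne_of_ne huo
      split_ifs <;> omega
    right
    by_cases hjp : j = p
    · exact Or.inr (Or.inl (hsum p q hβ hjp (by rintro rfl; omega) h.ne))
    by_cases hjq : j = q
    · by_cases hip : i = p
      · left
        subst hip hjq
        refine ⟨?_, ?_⟩
        · simp only [ev, vec]
          split_ifs <;> omega
        · apply Subtype.ext
          rw [LieSubalgebra.coe_bracket, coe_xMinus_sub, coe_xMinus_add, lie_elt]
          simp [h.ne', elt_inr_inl_self]
      · exact Or.inr (Or.inl (hsum q p hβ.symm hjq hip h.ne'))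
    by_cases hip : i = p
    · obtain ⟨h1, h2, h3⟩ := hdiff p q hβ hip hjq h.ne
      exact Or.inr (Or.inr ⟨h1, h2, Or.inl h3⟩)
    by_cases hiq : i = q
    · obtain ⟨h1, h2, h3⟩ := hdiff q p hβ.symm hiq hjp h.ne'
      exact Or.inr (Or.inr ⟨h1, h2, Or.inl h3⟩)
    left
    refine ⟨?_, lie_xMinus_sub_isSumRoot h' hβ hjp hjq⟩
    simp only [ev, vec]
    rw [Fin.ext_iff] at hip hiq hjp hjq
    split_ifs <;> omega
  | add i j h' =>
    have hij : (i : ℕ) < j := h'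
    have hα := isSumRoot_add i j h'
    have h0 := lie_xMinus_isSumRoot hα hβ
    -- Here α = ε_u + ε_x and β = ε_u + ε_y differ by ±(ε_x - ε_y); the order of x and y decides
    -- which of them is the larger root.
    have hcommon : ∀ u x y, IsSumRoot (add i j h') u x → IsSumRoot (add p q h) u y → u ≠ x →
        u ≠ y → x ≠ y → ((add i j h').ev (add p q h).vec = 1 ∧
          ⁅xMinus (add i j h'), xMinus (add p q h)⁆ = 0 ∧
          ((∃ δ, IsRootSum (add p q h) (add i j h') δ) ∨
          ∃ δ, IsRootSum (add i j h') (add p q h) δ ∧ ⁅xPlus (add p q h), xMinus δ⁆ = 0 ∧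
          (add p q h).ev δ.vec = -1)) := by
      intro u x y hx hy hux huy hxy
      have hux' := Fin.val_ne_of_ne hux
      have huy' := Fin.val_ne_of_ne huy
      have hxy' := Fin.val_ne_of_ne hxy
      refine ⟨?_, h0, ?_⟩
      · rw [hx.ev_eq]
        simp only [hy.vec_eq]
        split_ifs <;> omega
      rcases lt_or_gt_of_ne hxy with h1 | h1
      · right
        refine ⟨sub x y h1, isRootSum_sub h1 huy.symm hx hy,
          lie_xPlus_xMinus_sub h1 hy hux.symm hxy, ?_⟩
        rw [hy.ev_eq]
        simp only [vec]
        split_ifs <;> omega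
      · left
        exact ⟨sub y x h1, isRootSum_sub h1 hux.symm hy hx⟩
    by_cases hip : i = p
    · by_cases hjq : j = q
      · subst hip hjq; left; rfl
      · subst hip
        exact Or.inr (Or.inr (Or.inr (hcommon i j q hα hβ h'.ne h.ne hjq)))
    by_cases hiq : i = q
    · subst hiq
      exact Or.inr (Or.inr (Or.inr (hcommon i j p hα hβ.symm h'.ne h.ne' (by rintro rfl; omega))))
    by_cases hjp : j = p
    · subst hjp
      exact Or.inr (Or.inr (Or.inr (hcommon j i q hα.symm hβ h'.ne' h.ne hiq)))
    by_cases hjq : j = q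
    · subst hjq
      exact Or.inr (Or.inr (Or.inr (hcommon j i p hα.symm hβ.symm h'.ne' h.ne' hip)))
    right; left
    refine ⟨?_, h0⟩
    simp only [ev, vec]
    rw [Fin.ext_iff] at hip hiq hjp hjq
    split_ifs <;> omega

/-- The relative position of a positive and a negative root vector, the second one belonging to a
root `ε_p + ε_q`. -/
theorem lie_xPlus_xMinus_cases (α : PosRoot n) (p q : Fin n) (h : p < q) :
    α = add p q h ∨ ⁅xPlus α, xMinus (add p q h)⁆ = 0 ∨
    (∃ (δ : PosRoot n) (c : ℂ), ⁅xPlus α, xMinus (add p q h)⁆ = c • xMinus δ ∧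
      ∀ L, (add p q h).ev L = α.ev L + δ.ev L) ∨
    ∃ (δ : PosRoot n) (c : ℂ), ⁅xPlus α, xMinus (add p q h)⁆ = c • xPlus δ := by
  have hpq : (p : ℕ) < q := h
  have hβ := isSumRoot_add p q h
  cases α with
  | sub i j h' =>
    have hij : (i : ℕ) < j := h'
    have hdiff : ∀ u o, IsSumRoot (add p q h) u o → i = u → j ≠ o → u ≠ o →
        ∃ (δ : PosRoot n) (c : ℂ), ⁅xPlus (sub i j h'), xMinus (add p q h)⁆ = c • xMinus δ ∧
          ∀ L, (add p q h).ev L = (sub i j h').ev L + δ.ev L := by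
      rintro u o hu rfl hjo huo
      obtain ⟨δ, hδ⟩ := exists_isSumRoot hjo
      obtain ⟨c, hc, e⟩ := hδ.coe_xMinus
      obtain ⟨c', hc', e'⟩ := hu.coe_xMinus
      refine ⟨δ, -(c' * c⁻¹), ?_, fun L => by rw [hδ.ev_eq, hu.ev_eq, ev]; ring⟩
      apply Subtype.ext
      change ⁅(xPlus (sub i j h')).1, (xMinus (add p q h)).1⁆ = (-(c' * c⁻¹)) • (xMinus δ).1
      rw [coe_xPlus_sub, e', e, lie_smul, lie_elt, smul_smul, neg_mul, mul_assoc,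
        inv_mul_cancel₀ hc, mul_one]
      simp [huo]
    right
    by_cases hip : i = p
    · by_cases hjq : j = q
      · left
        subst hip hjq
        apply Subtype.ext
        rw [LieSubalgebra.coe_bracket, coe_xPlus_sub, coe_xMinus_add, lie_elt]
        simp [h.ne, elt_inr_inl_self]
      · exact Or.inr (Or.inl (hdiff p q hβ hip hjq h.ne))
    by_cases hiq : i = q
    · exact Or.inr (Or.inl (hdiff q p hβ.symm hiq (by rintro rfl; omega) h.ne'))
    left
    apply Subtype.ext
    rw [LieSubalgebra.coe_bracket, coe_xPlus_sub, coe_xMinus_add, lie_elt]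
    simp [hip, hiq]
  | add i j h' =>
    have hij : (i : ℕ) < j := h'
    have hα := isSumRoot_add i j h'
    -- The bracket is a multiple of `elt (.inl x) (.inl y)`, which is a positive or negative root
    -- vector according to the order of x and y.
    have hcommon : ∀ u x y, IsSumRoot (add i j h') u x → IsSumRoot (add p q h) u y → u ≠ x →
        u ≠ y → x ≠ y →
        (∃ (δ : PosRoot n) (c : ℂ), ⁅xPlus (add i j h'), xMinus (add p q h)⁆ = c • xMinus δ ∧
          ∀ L, (add p q h).ev L = (add i j h').ev L + δ.ev L) ∨
        ∃ (δ : PosRoot n) (c : ℂ),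
          ⁅xPlus (add i j h'), xMinus (add p q h)⁆ = c • xPlus δ := by
      intro u x y hx hy hux huy hxy
      obtain ⟨c, e⟩ := hx.coe_xPlus
      obtain ⟨c', hc', e'⟩ := hy.coe_xMinus
      have hb : ⁅(xPlus (add i j h')).1, (xMinus (add p q h)).1⁆ =
          (c * c') • elt (.inl x) (.inl y) := by
        rw [e, e', smul_lie, lie_smul, lie_elt, smul_smul]
        simp [hux.symm, huy, hxy, elt_inr_inr]
      rcases lt_or_gt_of_ne hxy with h1 | h1
      · right
        refine ⟨sub x y h1, c * c', ?_⟩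
        apply Subtype.ext
        change ⁅(xPlus (add i j h')).1, (xMinus (add p q h)).1⁆ = (c * c') • (xPlus _).1
        rw [hb, coe_xPlus_sub]
      · left
        refine ⟨sub y x h1, c * c', ?_, fun L => by rw [hy.ev_eq, hx.ev_eq, ev]; ring⟩
        apply Subtype.ext
        change ⁅(xPlus (add i j h')).1, (xMinus (add p q h)).1⁆ = (c * c') • (xMinus _).1
        rw [hb, coe_xMinus_sub]
    by_cases hip : i = p
    · by_cases hjq : j = q
      · subst hip hjq; left; rfl
      · subst hip
        exact Or.inr (Or.inr (hcommon i j q hα hβ h'.ne h.ne hjq))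
    by_cases hiq : i = q
    · subst hiq
      exact Or.inr (Or.inr (hcommon i j p hα hβ.symm h'.ne h.ne' (by rintro rfl; omega)))
    by_cases hjp : j = p
    · subst hjp
      exact Or.inr (Or.inr (hcommon j i q hα.symm hβ h'.ne' h.ne hiq))
    by_cases hjq : j = q
    · subst hjq
      exact Or.inr (Or.inr (hcommon j i p hα.symm hβ.symm h'.ne' h.ne' hip))
    right; left
    apply Subtype.ext
    rw [LieSubalgebra.coe_bracket, coe_xPlus_add, coe_xMinus_add, lie_elt]
    simp [hip, hiq, hjp, hjq]

/-! ### Computations in the enveloping algebra of the current algebra -/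

theorem cur_smul (c : ℂ) (x : g n) (r : ℕ) : cur (c • x) r = c • cur x r := by
  rw [cur, cur, TensorProduct.tmul_smul, map_smul]

theorem cur_zero (r : ℕ) : cur (0 : g n) r = 0 := by
  rw [cur, TensorProduct.tmul_zero, map_zero]

theorem cur_zsmul (c : ℤ) (x : g n) (r : ℕ) : cur (c • x) r = c • cur x r := by
  rw [← Int.cast_smul_eq_zsmul ℂ, cur_smul, Int.cast_smul_eq_zsmul]

theorem cur_mul_cur (x y : g n) (r s : ℕ) :
    cur x r * cur y s = cur y s * cur x r + cur ⁅x, y⁆ (r + s) := by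
  have h : cur ⁅x, y⁆ (r + s) = ⁅cur x r, cur y s⁆ := by
    rw [cur, cur, cur, ← LieHom.map_lie, LieAlgebra.ExtendScalars.bracket_tmul, pow_add]
  rw [h, Ring.lie_def]
  abel

theorem cur_commute {x y : g n} (h : ⁅x, y⁆ = 0) (r s : ℕ) :
    cur x r * cur y s = cur y s * cur x r := by
  rw [cur_mul_cur, h, cur_zero, add_zero]

theorem isSl2Loop_cur (α : PosRoot n) :
    IsSl2Loop (cur (xPlus α)) (cur (coroot α)) (cur (xMinus α)) where
  ef r s := by rw [cur_mul_cur, lie_xPlus_xMinus]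
  hf r s := by
    rw [cur_mul_cur, lie_coroot_xMinus, ev_vec_self, cur_zsmul, neg_smul, ← sub_eq_add_neg,
      zsmul_eq_mul, Int.cast_ofNat]
  ff r s := cur_commute (lie_self _) r s

/-- Applying h_(k+1) to f_p w = 0 leaves -2 f_(p+k+1) w, as h_(k+1) kills w. -/
theorem _root_.IsSl2LoopVector.smul_eq_zero_of_le {A M : Type*} [Ring A] [AddCommGroup M]
    [Module A M] [Module ℂ M] {e h f : ℕ → A} {c : ℤ} {w : M} (hA : IsSl2Loop e h f)
    (hw : IsSl2LoopVector e h f c w) {p : ℕ} (hp : f p • w = 0) {i : ℕ} (hi : p ≤ i) :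
    f i • w = 0 := by
  obtain rfl | hi := hi.eq_or_lt
  · exact hp
  · obtain ⟨k, rfl⟩ := Nat.exists_eq_add_of_lt hi
    have h1 := congrArg (· • w) (hA.hf (k + 1) p)
    simp only [mul_smul, sub_smul, hp, hw.cartan, smul_zero, zero_sub] at h1
    rw [eq_comm, neg_eq_zero, show k + 1 + p = p + k + 1 by ring] at h1
    exact eq_zero_of_natCast_smul (A := A) two_ne_zero (by exact_mod_cast h1)

theorem cur_smul_smul {M : Type*} [AddCommGroup M] [Module (U n) M] (x y : g n) (r s : ℕ) (v : M) :
    cur x r • cur y s • v = cur y s • cur x r • v + cur ⁅x, y⁆ (r + s) • v := by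
  rw [← mul_smul, cur_mul_cur, add_smul, mul_smul]

theorem preservesNil_cur {M : Type*} [AddCommGroup M] [Module (U n) M] (α : PosRoot n) (y : g n)
    (r : ℕ) : PreservesNil (cur (xMinus α) 0) (cur y r) M := by
  refine .of_commutator (cur_mul_cur _ _ _ _) ?_
  refine .of_commutator (cur_mul_cur _ _ _ _) ?_
  refine .of_commutator (cur_mul_cur _ _ _ _) ?_
  rw [lie_lie_lie_xMinus, cur_zero]
  exact .zero _

section

variable {M : Type*} [AddCommGroup M] [Module ℂ M] [Module (U n) M] [IsScalarTower ℂ (U n) M]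

/-- The enveloping algebra is spanned by products of elements y ⊗ t^r, and each of these preserves
nilpotent vectors since (ad x_α⁻)³ = 0. Nilpotency on a cyclic generator therefore spreads to the
whole module. -/
theorem preservesNil_all (α : PosRoot n) (u : U n) : PreservesNil (cur (xMinus α) 0) u M := by
  have hu : u ∈ ⨆ k, uPiece n k := by rw [iSup_uPiece]; exact Submodule.mem_top
  induction hu using Submodule.iSup_induction' with
  | zero => exact .zero _
  | add u v _ _ hu hv => exact hu.add hv
  | mem k u hu =>
    induction hu using Submodule.span_induction with
    | zero => exact .zero _
    | add u v _ _ hu hv => exact hu.add hv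
    | smul c u _ hu =>
      intro v hv
      obtain ⟨N, hN⟩ := hu v hv
      refine ⟨N, ?_⟩
      rw [smul_assoc, ← algebraMap_smul (U n) c, ← mul_smul, ← (Algebra.commutes c _),
        mul_smul, hN, smul_zero]
    | mem u hu =>
      obtain ⟨l, -, rfl⟩ := hu
      induction l with
      | nil => exact .one _
      | cons a l ih => rw [List.map_cons, List.prod_cons]; exact (preservesNil_cur α _ _).mul ih

theorem isLocNilp_of_cyclic (α : PosRoot n) {v : M} (hv : Submodule.span (U n) {v} = ⊤)
    (h : ∃ N, cur (xMinus α) 0 ^ N • v = 0) : IsLocNilp (cur (xMinus α) 0) M := by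
  intro w
  have hw : w ∈ Submodule.span (U n) {v} := by rw [hv]; exact Submodule.mem_top
  obtain ⟨u, rfl⟩ := Submodule.mem_span_singleton.1 hw
  exact preservesNil_all α u v h

theorem isLocNilp_of_lie {α γ δ : PosRoot n} {c : ℂ} (hc : c ≠ 0)
    (h : ⁅xMinus δ, xMinus γ⁆ = c • xMinus α) (hδ : ⁅xMinus δ, xMinus α⁆ = 0)
    (hγ : ⁅xMinus γ, xMinus α⁆ = 0) (hnδ : IsLocNilp (cur (xMinus δ) 0) M)
    (hnγ : IsLocNilp (cur (xMinus γ) 0) M) : IsLocNilp (cur (xMinus α) 0) M := by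
  have h1 : IsLocNilp (c • cur (xMinus α) 0) M := by
    refine IsLocNilp.of_heisenberg hnδ hnγ ?_ ?_ ?_
    · rw [cur_mul_cur, h, cur_smul]
    · rw [mul_smul_comm, smul_mul_assoc, cur_commute hδ]
    · rw [mul_smul_comm, smul_mul_assoc, cur_commute hγ]
  intro v
  obtain ⟨N, hN⟩ := h1 v
  refine ⟨N, ?_⟩
  rw [smul_pow, smul_assoc, smul_eq_zero] at hN
  exact hN.resolve_left (pow_ne_zero _ hc)

theorem IsRootSum.isLocNilp {α γ δ : PosRoot n} (h : IsRootSum α γ δ)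
    (hγ : ⁅xMinus γ, xMinus α⁆ = 0) (hnδ : IsLocNilp (cur (xMinus δ) 0) M)
    (hnγ : IsLocNilp (cur (xMinus γ) 0) M) : IsLocNilp (cur (xMinus α) 0) M := by
  obtain ⟨c, hc, e⟩ := h.lie_eq
  exact isLocNilp_of_lie hc e h.lie_eq_zero hγ hnδ hnγ

theorem lie_xMinus_sub_sub {i j k l : Fin n} (h : i < j) (h' : k < l) (hil : i ≠ l)
    (hjk : j ≠ k) : ⁅xMinus (sub i j h), xMinus (sub k l h')⁆ = 0 := by
  apply Subtype.ext
  rw [LieSubalgebra.coe_bracket, coe_xMinus_sub, coe_xMinus_sub, lie_elt]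
  simp [hil, hjk]

theorem isSimple_sub (i j : Fin n) (h : i < j) (hj : (j : ℕ) = i + 1) :
    (sub i j h).IsSimple := by
  refine ⟨i, ?_⟩
  ext k
  simp only [coeff, Pi.single_apply, Fin.le_def, Fin.lt_def, Fin.ext_iff]
  split_ifs <;> omega

theorem isSimple_add (i j : Fin n) (h : i < j) (hi : (i : ℕ) + 2 = n) :
    (add i j h).IsSimple := by
  have hij : (i : ℕ) < j := h
  refine ⟨j, ?_⟩
  ext k
  simp only [coeff, Pi.single_apply, Fin.le_def, Fin.ext_iff]
  split_ifs <;> omega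

/-- If the negative simple root vectors are locally nilpotent, so are all the negative root
vectors. -/
theorem isLocNilp_of_simple
    (hs : ∀ α : PosRoot n, α.IsSimple → IsLocNilp (cur (xMinus α) 0) M) (α : PosRoot n) :
    IsLocNilp (cur (xMinus α) 0) M := by
  -- Induction on height through ε_i - ε_j = (ε_i - ε_(j-1)) + (ε_(j-1) - ε_j).
  have hsub : ∀ (m : ℕ) (i j : Fin n) (h : i < j), (j : ℕ) = i + 1 + m →
      IsLocNilp (cur (xMinus (sub i j h)) 0) M := by
    intro m
    induction m with
    | zero => exact fun i j h hj => hs _ (isSimple_sub i j h hj)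
    | succ m ih =>
      intro i j h hj
      have hk : (j : ℕ) - 1 < n := by omega
      have hik : i < (⟨j - 1, hk⟩ : Fin n) := by rw [Fin.lt_def]; simp only; omega
      have hkj : (⟨j - 1, hk⟩ : Fin n) < j := by rw [Fin.lt_def]; simp only; omega
      have h1 := ih i ⟨j - 1, hk⟩ hik (by simp only; omega)
      have h2 := hs _ (isSimple_sub ⟨j - 1, hk⟩ j hkj (by simp only; omega))
      refine isLocNilp_of_lie (c := 1) one_ne_zero ?_
        (lie_xMinus_sub_sub hkj h hkj.ne h.ne') (lie_xMinus_sub_sub hik h h.ne hik.ne') h2 h1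
      apply Subtype.ext
      rw [one_smul, LieSubalgebra.coe_bracket, coe_xMinus_sub, coe_xMinus_sub, coe_xMinus_sub,
        lie_elt]
      simp [h.ne']
  have hsub' : ∀ (i j : Fin n) (h : i < j), IsLocNilp (cur (xMinus (sub i j h)) 0) M := by
    intro i j h
    have : (i : ℕ) < j := h
    exact hsub (j - i - 1) i j h (by omega)
  -- Splits ε_i + ε_(n-1) as (ε_i - ε_(n-2)) + (ε_(n-2) + ε_(n-1)), whose second summand is simple.
  -- A general ε_i + ε_j is then (ε_j - ε_(n-1)) + (ε_i + ε_(n-1)).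
  have hlast : ∀ (i j : Fin n) (h : i < j), (j : ℕ) + 1 = n →
      IsLocNilp (cur (xMinus (add i j h)) 0) M := by
    intro i j h hj
    have hij : (i : ℕ) < j := h
    by_cases hi : (i : ℕ) + 2 = n
    · exact hs _ (isSimple_add i j h hi)
    · have hk : (j : ℕ) - 1 < n := by omega
      have hik : i < (⟨j - 1, hk⟩ : Fin n) := by rw [Fin.lt_def]; simp only; omega
      have hkj : (⟨j - 1, hk⟩ : Fin n) < j := by rw [Fin.lt_def]; simp only; omega
      have hα := (isSumRoot_add i j h).symm
      have hγ := (isSumRoot_add _ j hkj).symm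
      exact (isRootSum_sub hik hkj.ne hα hγ).isLocNilp (lie_xMinus_isSumRoot hγ hα) (hsub' _ _ _)
        (hs _ (isSimple_add _ j hkj (by simp only; omega)))
  cases α with
  | sub i j h => exact hsub' i j h
  | add i j h =>
    have hij : (i : ℕ) < j := h
    by_cases hj : (j : ℕ) + 1 = n
    · exact hlast i j h hj
    · have hk : n - 1 < n := by omega
      have hjk : j < (⟨n - 1, hk⟩ : Fin n) := by rw [Fin.lt_def]; simp only; omega
      have hα := isSumRoot_add i j h
      have hγ := isSumRoot_add i _ (h.trans hjk)
      exact (isRootSum_sub hjk (h.trans hjk).ne' hα hγ).isLocNilp (lie_xMinus_isSumRoot hγ hα)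
        (hsub' _ _ _) (hlast _ _ _ (by simp only; omega))

/-! ### Highest weight vectors for the current algebra -/

/-- The vector `v` satisfies the relations `S`. -/
def Satisfies {M : Type*} [AddCommGroup M] [Module (U n) M] (S : U n → Prop) (v : M) : Prop :=
  ∀ u, S u → u • v = 0

theorem isDominant_pair_eq {lam : Weight n} (h : IsDominant lam) (α : PosRoot n) :
    ∃ m : ℕ, (m : ℤ) = pair lam α := ⟨(pair lam α).toNat, Int.toNat_of_nonneg (pair_nonneg h α)⟩

theorem Satisfies.isLocNilp {lam : Weight n} (hlam : IsDominant lam) {v : M}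
    (hv : Satisfies (WeylRel lam) v) (hspan : Submodule.span (U n) {v} = ⊤) (α : PosRoot n) :
    IsLocNilp (cur (xMinus α) 0) M := by
  refine isLocNilp_of_simple (fun γ hγ => ?_) α
  obtain ⟨m, hm⟩ := isDominant_pair_eq hlam γ
  exact isLocNilp_of_cyclic γ hspan ⟨m + 1, hv _ (.lowering γ hγ m hm)⟩

theorem Satisfies.coroot_smul {lam : Weight n} {v : M} (hv : Satisfies (WeylRel lam) v)
    (α : PosRoot n) (r : ℕ) :
    cur (coroot α) r • v = if r = 0 then pair lam α • v else 0 := by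
  have h := hv _ (.cartan α r)
  rw [sub_smul, sub_eq_zero] at h
  rw [h, algebraMap_smul]
  split_ifs
  · rw [Int.cast_smul_eq_zsmul]
  · rw [zero_smul]

theorem Satisfies.isSl2LoopVector {lam : Weight n} {v : M} (hv : Satisfies (WeylRel lam) v)
    {α : PosRoot n} (hα : IsLocNilp (cur (xMinus α) 0) M) :
    IsSl2LoopVector (cur (xPlus α)) (cur (coroot α)) (cur (xMinus α)) (pair lam α) v where
  raise r := hv _ (.raising α r)
  weight := by rw [hv.coroot_smul, if_pos rfl]
  cartan r := by rw [hv.coroot_smul, if_neg (Nat.succ_ne_zero r)]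
  nilp := hα v

end

/-- The hypothesis over all linear forms says α = γ + δ; coroots add in the same way because D_n is
simply laced. -/
theorem pair_eq_of_ev {α γ δ : PosRoot n} (h : ∀ L, α.ev L = γ.ev L + δ.ev L) (lam : Weight n) :
    pair lam α = pair lam γ + pair lam δ := by
  have h1 := two_mul_pair lam α
  have h2 := two_mul_pair lam γ
  have h3 := two_mul_pair lam δ
  have h4 := h (twoCoord lam)
  omega

/-- The position of `β = ε_p + ε_q` relative to dominant weights `a` and `b` with `a - b` having
orthogonal coordinates `L`. -/
structure IsMinimalPair (a b : Weight n) (p q : Fin n) (h : p < q) (L : ℕ → ℤ) : Prop where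
  left : IsDominant a
  right : IsDominant b
  coord : ∀ i, L i = 0 ∨ L i = 1
  coord_p : L p = 1
  coord_q : L q = 1
  maximal : ∀ k < n, L k = 1 → k = q ∨ k ≤ p
  pair_eq : ∀ α : PosRoot n, pair a α - pair b α = α.ev L

/-! ### Relations in V(a, b) and in its quotient by x_β⁻ ⊗ t^s -/

namespace IsMinimalPair

variable {a b : Weight n} {p q : Fin n} {h : p < q} {L : ℕ → ℤ}

theorem ev_le (H : IsMinimalPair a b p q h L) (α : PosRoot n) : -1 ≤ α.ev L ∧ α.ev L ≤ 2 := by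
  cases α with
  | sub i j _ =>
    have := H.coord i
    have := H.coord j
    simp only [ev]
    omega
  | add i j _ =>
    have := H.coord i
    have := H.coord j
    simp only [ev]
    omega

theorem pair_beta (H : IsMinimalPair a b p q h L) :
    pair a (add p q h) - pair b (add p q h) = 2 := by
  rw [H.pair_eq, ev, H.coord_p, H.coord_q]; rfl

/-- A root with `L`-value two is obtained from `β` by adding positive multiples of
`ε_i - ε_j`. -/
theorem ev_two (H : IsMinimalPair a b p q h L) {i j : Fin n} {hij : i < j}
    (h2 : (add i j hij).ev L = 2) : L i = 1 ∧ L j = 1 ∧ i ≤ p ∧ (j = q ∨ j ≤ p) := by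
  have hi := H.coord i
  have hj := H.coord j
  simp only [ev] at h2
  have hi1 : L i = 1 := by omega
  have hj1 : L j = 1 := by omega
  have hmi := H.maximal i i.2 hi1
  have hmj := H.maximal j j.2 hj1
  have hij' : (i : ℕ) < j := hij
  have hpq : (p : ℕ) < q := h
  refine ⟨hi1, hj1, ?_, ?_⟩
  · rw [Fin.le_def]; omega
  · rw [Fin.le_def, Fin.ext_iff]; omega

/-- The two L-values add up to 2 and each is at most 2, so it suffices to exclude 2. A root of
L-value 2 dominates β and cannot be a proper summand of it. -/
theorem ev_of_sum (H : IsMinimalPair a b p q h L) {α δ : PosRoot n}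
    (hs : ∀ L, (add p q h).ev L = α.ev L + δ.ev L) : α.ev L = 1 ∧ δ.ev L = 1 := by
  have key : ∀ {α δ : PosRoot n}, (∀ L, (add p q h).ev L = α.ev L + δ.ev L) → δ.ev L ≠ 2 := by
    intro α δ hs h2
    cases δ with
    | sub i j hij =>
      have := H.coord i
      have := H.coord j
      simp only [ev] at h2
      omega
    | add i j hij =>
      obtain ⟨-, -, hip, hjp⟩ := H.ev_two h2
      have hpq : (p : ℕ) < q := h
      have hij' : (i : ℕ) < j := hij
      rw [Fin.le_def] at hip
      rw [Fin.le_def, Fin.ext_iff] at hjp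
      -- The form k ↦ n - k is positive on all positive roots, and its value at ε_i + ε_j is at
      -- least its value at β because i ≤ p and j ≤ q.
      have e : ((n : ℤ) - p) + (n - q) = (α.ev fun k => (n : ℤ) - k) + ((n - i) + (n - j)) :=
        hs fun k => (n : ℤ) - k
      have hpos : 0 < α.ev fun k => (n : ℤ) - k := by
        cases α with
        | sub k l hkl =>
          have : (k : ℕ) < l := hkl
          simp only [ev]
          omega
        | add k l hkl =>
          simp only [ev]
          omega
      omega
  have h1 := key hs
  have h2 := key (α := δ) (δ := α) fun L => by rw [hs, add_comm]
  have e : 2 = α.ev L + δ.ev L := by rw [← hs, ev, H.coord_p, H.coord_q]; rfl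
  have e1 := H.ev_le α
  have e2 := H.ev_le δ
  omega

theorem weyl {M : Type*} [AddCommGroup M] [Module (U n) M] {v : M}
    (hv : Satisfies (VRel a b) v) : Satisfies (WeylRel (a + b)) v :=
  fun u hu => hv u (.weyl u hu)

variable {M : Type*} [AddCommGroup M] [Module ℂ M] [Module (U n) M] [IsScalarTower ℂ (U n) M]
  {v : M}

theorem isLocNilp (H : IsMinimalPair a b p q h L) (hv : Satisfies (VRel a b) v)
    (hspan : Submodule.span (U n) {v} = ⊤) (α : PosRoot n) :
    IsLocNilp (cur (xMinus α) 0) M :=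
  (weyl hv).isLocNilp (fun i => add_nonneg (H.left i) (H.right i)) hspan α

theorem isSl2LoopVector (H : IsMinimalPair a b p q h L) (hv : Satisfies (VRel a b) v)
    (hspan : Submodule.span (U n) {v} = ⊤) (α : PosRoot n) :
    IsSl2LoopVector (cur (xPlus α)) (cur (coroot α)) (cur (xMinus α)) (pair a α + pair b α) v := by
  rw [← pair_add_weight]
  exact (weyl hv).isSl2LoopVector (H.isLocNilp hv hspan α)

theorem smul_eq_zero (H : IsMinimalPair a b p q h L) (hv : Satisfies (VRel a b) v)
    (hspan : Submodule.span (U n) {v} = ⊤) {α : PosRoot n} {i : ℕ} (ha : pair a α ≤ i)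
    (hb : pair b α ≤ i) : cur (xMinus α) i • v = 0 := by
  have h0 := pair_nonneg H.left α
  have hm : ((max (pair a α) (pair b α)).toNat : ℤ) = max (pair a α) (pair b α) :=
    Int.toNat_of_nonneg (le_max_of_le_left h0)
  exact (H.isSl2LoopVector hv hspan α).smul_eq_zero_of_le (isSl2Loop_cur α)
    (hv _ (.bound α _ hm)) (by omega)

theorem smul_sq_eq_zero (H : IsMinimalPair a b p q h L) (hv : Satisfies (VRel a b) v)
    (hspan : Submodule.span (U n) {v} = ⊤) {α : PosRoot n} {i : ℕ} (ha : pair a α = i + 1)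
    (hb : pair b α ≤ i) : cur (xMinus α) i • cur (xMinus α) i • v = 0 := by
  rw [← mul_smul, ← pow_two]
  refine (H.isSl2LoopVector hv hspan α).top_pow_smul (isSl2Loop_cur α)
    (fun k hk => H.smul_eq_zero hv hspan ?_ ?_) ?_
  · omega
  · omega
  · push_cast; omega

/-- The consequence of applying `x_δ⁻` to a vanishing square of `x_α⁻`. -/
theorem _root_.TypeD.IsRootSum.mul_smul_eq_zero {γ α δ : PosRoot n} (hs : IsRootSum γ α δ)
    (hc : ⁅xMinus α, xMinus γ⁆ = 0) {r k : ℕ}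
    (h₁ : cur (xMinus α) r • cur (xMinus α) r • v = 0)
    (h₂ : cur (xMinus α) r • cur (xMinus α) r • cur (xMinus δ) k • v = 0) :
    cur (xMinus α) r • cur (xMinus γ) (k + r) • v = 0 := by
  obtain ⟨c, hc0, e⟩ := hs.lie_eq
  -- Moving x_δ⁻ to the right through the square produces two cross terms, equal because x_α⁻ and
  -- x_γ⁻ commute; their sum is 2c times the desired vector.
  have h3 := congrArg (cur (xMinus δ) k • ·) h₁
  simp only [smul_zero] at h3
  rw [cur_smul_smul, cur_smul_smul (xMinus δ) (xMinus α), e, smul_add, h₂, zero_add, cur_smul,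
    smul_assoc, smul_assoc, smul_comm _ c, ← mul_smul, cur_commute hc, mul_smul, ← two_smul ℂ,
    _root_.smul_eq_zero, _root_.smul_eq_zero] at h3
  rw [← mul_smul, cur_commute hc, mul_smul]
  simpa [hc0] using h3

/-- `x_β⁻ ⊗ t^s` applied to the generator of `V(a, b)` is a highest weight vector. -/
theorem isSl2LoopVector_smul (H : IsMinimalPair a b p q h L) (hv : Satisfies (VRel a b) v)
    (hspan : Submodule.span (U n) {v} = ⊤) {s : ℕ} (hs : (s : ℤ) = pair a (add p q h) - 1)
    (α : PosRoot n) :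
    IsSl2LoopVector (cur (xPlus α)) (cur (coroot α)) (cur (xMinus α))
      (pair a α + pair b α - α.ev (add p q h).vec) (cur (xMinus (add p q h)) s • v) := by
  have hβ := H.pair_beta
  have hβb := pair_nonneg H.right (add p q h)
  have hw := weyl hv
  have hcar : ∀ r, cur (coroot α) r • cur (xMinus (add p q h)) s • v =
      if r = 0 then (pair a α + pair b α - α.ev (add p q h).vec) •
        cur (xMinus (add p q h)) s • v else 0 := by
    intro r
    rw [cur_smul_smul, hw.coroot_smul, lie_coroot_xMinus, cur_zsmul, smul_assoc]
    split_ifs with hr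
    · rw [hr, zero_add, smul_comm, ← add_smul, pair_add_weight]; rfl
    · rw [smul_zero, zero_add, H.smul_eq_zero hv hspan (by omega) (by omega), smul_zero]
  refine ⟨fun r => ?_, ?_, fun r => ?_, H.isLocNilp hv hspan α _⟩
  · rw [cur_smul_smul, hw _ (.raising α r), smul_zero, zero_add]
    rcases lie_xPlus_xMinus_cases α p q h with rfl | h0 | ⟨δ, c, e, hsum⟩ | ⟨δ, c, e⟩
    -- The degree r + s is positive, since a(h_β) = b(h_β) + 2 forces s ≥ 1.
    · rw [lie_xPlus_xMinus, hw.coroot_smul, if_neg (by omega)]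
    · rw [h0, cur_zero, zero_smul]
    -- As L(α) = 1, one has a(h_α) ≥ 1, hence a(h_δ) ≤ a(h_β) - 1 = s and x_δ⁻ ⊗ t^(r+s) kills v.
    · have h1 := H.ev_of_sum hsum
      have h2 := H.pair_eq α
      have h3 := H.pair_eq δ
      have h4 := pair_nonneg H.right α
      have h5 := pair_eq_of_ev hsum a
      rw [e, cur_smul, smul_assoc, H.smul_eq_zero hv hspan (by push_cast; omega)
        (by push_cast; omega), smul_zero]
    · rw [e, cur_smul, smul_assoc, hw _ (.raising δ _), smul_zero]
  · rw [hcar, if_pos rfl]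
  · rw [hcar, if_neg (Nat.succ_ne_zero r)]

/-- The cases follow the inner product of α and β. For 0 the root vectors commute; for -1 the
bracket lies in the root α + β, in a degree that kills v. For α = β a coefficient of F² is used, and
for 1 a vanishing square is bracketed with the vector of the difference root. -/
theorem bound_smul (H : IsMinimalPair a b p q h L) (hv : Satisfies (VRel a b) v)
    (hspan : Submodule.span (U n) {v} = ⊤) {s : ℕ} (hs : (s : ℤ) = pair a (add p q h) - 1)
    (α : PosRoot n) {t : ℕ}
    (ht : (t : ℤ) = max (pair a α - α.ev (add p q h).vec) (pair b α)) :
    cur (xMinus α) t • cur (xMinus (add p q h)) s • v = 0 := by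
  have hβ := H.pair_beta
  have hβb := pair_nonneg H.right (add p q h)
  have hαd := H.pair_eq α
  have hα0 := pair_nonneg H.right α
  have hα0' := pair_nonneg H.left α
  rcases lie_xMinus_cases α p q h with rfl | ⟨hip, h0⟩ | ⟨hip, δ, c, e, hsum⟩ |
    ⟨hip, h0, ⟨δ, hδ⟩ | ⟨δ, hδ, hplus, hδβ⟩⟩
  · rw [ev_vec_self] at ht
    -- Here a(h_β) = s + 1 and b(h_β) = s - 1, so t = s - 1 and the weight is 2s, just below the
    -- bound 2s + 1 of `top_mul_smul`.
    obtain ⟨m, rfl⟩ : ∃ m, s = m + 1 := ⟨s - 1, by omega⟩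
    obtain rfl : t = m := by omega
    refine (H.isSl2LoopVector hv hspan (add p q h)).top_mul_smul (isSl2Loop_cur _)
      (fun k hk => H.smul_eq_zero hv hspan ?_ ?_) ?_
    · omega
    · omega
    · push_cast; omega
  · rw [← mul_smul, cur_commute h0, mul_smul, H.smul_eq_zero hv hspan (by omega) (by omega),
      smul_zero]
  · have ha := pair_eq_of_ev hsum a
    have hb := pair_eq_of_ev hsum b
    rw [cur_smul_smul, H.smul_eq_zero hv hspan (by omega) (by omega), smul_zero, zero_add, e,
      cur_smul, smul_assoc, H.smul_eq_zero hv hspan (by push_cast; omega) (by push_cast; omega),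
      smul_zero]
  -- Case β = α + δ: then t = a(h_α) - 1 and s = t + a(h_δ). The square of x_α⁻ ⊗ t^t kills v, and
  -- so does x_δ⁻ in degree a(h_δ).
  · obtain ⟨h1, h2⟩ := H.ev_of_sum hδ.ev_eq
    have hδd := H.pair_eq δ
    have hδ0 := pair_nonneg H.left δ
    have ha := pair_eq_of_ev hδ.ev_eq a
    obtain ⟨k, hk⟩ := isDominant_pair_eq H.left δ
    obtain rfl : s = k + t := by omega
    refine hδ.mul_smul_eq_zero h0 (H.smul_sq_eq_zero hv hspan (by omega) (by omega)) ?_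
    rw [H.smul_eq_zero hv hspan (α := δ) (by omega) (by omega), smul_zero, smul_zero]
  · have h0' : ⁅xMinus (add p q h), xMinus α⁆ = 0 := by rw [← lie_skew, h0, neg_zero]
    have hev := hδ.ev_eq L
    have hδd := H.pair_eq δ
    have hδ1 := H.ev_le δ
    have hα1 := H.ev_le α
    have hβL : (add p q h).ev L = 2 := by rw [← H.pair_eq]; exact hβ
    have ha := pair_eq_of_ev hδ.ev_eq a
    have hb := pair_eq_of_ev hδ.ev_eq b
    obtain ⟨k, hk⟩ := isDominant_pair_eq H.left δ
    by_cases hα : α.ev L ≤ 0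
    · rw [← mul_smul, cur_commute h0, mul_smul, H.smul_eq_zero hv hspan (by omega) (by omega),
        smul_zero]
    obtain rfl : t = k + s := by omega
    rw [← mul_smul, cur_commute h0, mul_smul]
    have hw := weyl hv
    -- Case α = β + δ: the roles are exchanged, and now the square of x_β⁻ ⊗ t^s must also kill x_δ⁻
    -- ⊗ t^k v. This vector is of highest weight for the loop sl₂ of β, of weight 2s + 1 because (β,
    -- δ) = -1, and 2s + 1 < 2(s + 1).
    have hu : IsSl2LoopVector (cur (xPlus (add p q h))) (cur (coroot (add p q h)))
        (cur (xMinus (add p q h))) (2 * s + 1) (cur (xMinus δ) k • v) := by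
      have hcar : ∀ r, cur (coroot (add p q h)) r • cur (xMinus δ) k • v =
          if r = 0 then (2 * s + 1 : ℤ) • cur (xMinus δ) k • v else 0 := by
        intro r
        rw [cur_smul_smul, hw.coroot_smul, lie_coroot_xMinus, cur_zsmul, smul_assoc, hδβ]
        split_ifs with hr
        · rw [hr, zero_add, smul_comm, ← add_smul, pair_add_weight]
          congr 1
          omega
        · rw [smul_zero, zero_add, H.smul_eq_zero hv hspan (by push_cast; omega)
            (by push_cast; omega), smul_zero]
      refine ⟨fun r => ?_, ?_, fun r => ?_, H.isLocNilp hv hspan _ _⟩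
      · rw [cur_smul_smul, hw _ (.raising _ r), smul_zero, zero_add, hplus, cur_zero, zero_smul]
      · rw [hcar, if_pos rfl]
      · rw [hcar, if_neg (Nat.succ_ne_zero r)]
    refine hδ.mul_smul_eq_zero h0' (H.smul_sq_eq_zero hv hspan (by omega) (by omega)) ?_
    rw [← mul_smul, ← pow_two]
    refine hu.top_pow_smul (isSl2Loop_cur _) (fun i hi => ?_) (by push_cast; omega)
    obtain ⟨c, -, e⟩ := hδ.lie_eq
    rw [cur_smul_smul, H.smul_eq_zero hv hspan (by omega) (by omega), smul_zero, zero_add,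
      ← lie_skew, e, ← neg_smul, cur_smul, smul_assoc,
      H.smul_eq_zero hv hspan (by push_cast; omega) (by push_cast; omega), smul_zero]

/-- `x_β⁻ ⊗ t^s` applied to the generator of `V(a, b)` satisfies the relations of `V(a - β, b)`. -/
theorem satisfies_smul (H : IsMinimalPair a b p q h L) (hn : 3 ≤ n) (hv : Satisfies (VRel a b) v)
    (hspan : Submodule.span (U n) {v} = ⊤) {s : ℕ} (hs : (s : ℤ) = pair a (add p q h) - 1) :
    Satisfies (VRel (a - rootWeight (add p q h)) b) (cur (xMinus (add p q h)) s • v) := by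
  have hpair : ∀ α : PosRoot n, pair (a - rootWeight (add p q h) + b) α =
      pair a α + pair b α - α.ev (add p q h).vec := fun α => by
    rw [pair_add_weight, pair_sub_weight, pair_rootWeight hn]; ring
  have hsl := H.isSl2LoopVector_smul hv hspan hs
  rintro u (⟨u, hu⟩ | ⟨α, t, ht⟩)
  · cases hu with
    | raising α r => exact (hsl α).raise r
    | cartan α r =>
      rw [sub_smul, sub_eq_zero, algebraMap_smul]
      cases r with
      | zero => rw [(hsl α).weight, if_pos rfl, hpair, Int.cast_smul_eq_zsmul]
      | succ r => rw [(hsl α).cartan, if_neg (Nat.succ_ne_zero r), zero_smul]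
    | lowering α hα m hm =>
      refine (hsl α).pow_smul_eq_zero (isSl2Loop_cur α) ?_
      rw [hpair] at hm
      push_cast
      omega
  · rw [pair_sub_weight, pair_rootWeight hn] at ht
    exact H.bound_smul hv hspan hs α ht

/-- Since L(δ) = 0, a and b agree on h_δ and x_δ⁻ ⊗ t^(a(h_δ)) kills v. Its bracket with x_α⁻ ⊗
t^(a(h_α)-1) is a nonzero multiple of x_γ⁻ ⊗ t^(a(h_γ)-1). -/
theorem smul_eq_zero_of_sum (H : IsMinimalPair a b p q h L) (hv : Satisfies (VRel a b) v)
    (hspan : Submodule.span (U n) {v} = ⊤) {γ α δ : PosRoot n} (hs : IsRootSum γ α δ)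
    (hδ : δ.ev L = 0) (h0 : ∀ t : ℕ, (t : ℤ) = pair a α - 1 → cur (xMinus α) t • v = 0)
    (h1 : 1 ≤ pair a α) {t : ℕ} (ht : (t : ℤ) = pair a γ - 1) : cur (xMinus γ) t • v = 0 := by
  obtain ⟨c, hc, e⟩ := hs.lie_eq
  have ha := pair_eq_of_ev hs.ev_eq a
  have hδd := H.pair_eq δ
  obtain ⟨k, hk⟩ := isDominant_pair_eq H.left δ
  obtain ⟨r, hr⟩ := isDominant_pair_eq H.left α
  have key := cur_smul_smul (xMinus δ) (xMinus α) k (r - 1) v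
  rw [h0 (r - 1) (by omega), H.smul_eq_zero hv hspan (α := δ) (by omega) (by omega), smul_zero,
    smul_zero, zero_add, e, cur_smul, smul_assoc, show k + (r - 1) = t by omega, eq_comm,
    _root_.smul_eq_zero] at key
  exact key.resolve_left hc

/-- If `x_β⁻ ⊗ t^s` kills the generator, then so do the analogous elements for all other roots in
`R(λ₁, λ₂)`. -/
theorem smul_eq_zero_of_ev_two (H : IsMinimalPair a b p q h L) (hv : Satisfies (VRel a b) v)
    (hspan : Submodule.span (U n) {v} = ⊤)
    (h0 : ∀ t : ℕ, (t : ℤ) = pair a (add p q h) - 1 → cur (xMinus (add p q h)) t • v = 0)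
    {γ : PosRoot n} (hγ : γ.ev L = 2) {t : ℕ} (ht : (t : ℤ) = pair a γ - 1) :
    cur (xMinus γ) t • v = 0 := by
  cases γ with
  | sub i j hij =>
    have := H.coord i
    have := H.coord j
    simp only [ev] at hγ
    omega
  | add i j hij =>
    obtain ⟨hi, hj, hip, hjq⟩ := H.ev_two hγ
    have hiq : i < q := lt_of_le_of_lt hip h
    -- The passage from ε_p + ε_q to ε_i + ε_j goes through ε_i + ε_q, adding first ε_i - ε_p and
    -- then ε_j - ε_q; both have L-value 0.
    have hstep : ∀ t : ℕ, (t : ℤ) = pair a (add i q hiq) - 1 →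
        cur (xMinus (add i q hiq)) t • v = 0 := by
      intro t ht
      obtain rfl | hip := hip.eq_or_lt
      · exact h0 t ht
      · have hβ := H.pair_beta
        have hβb := pair_nonneg H.right (add p q h)
        refine H.smul_eq_zero_of_sum hv hspan
          (isRootSum_sub hip h.ne (isSumRoot_add i q hiq).symm (isSumRoot_add p q h).symm)
          ?_ h0 (by omega) ht
        rw [ev, hi, H.coord_p]; rfl
    rcases hjq with rfl | hjp
    · exact hstep t ht
    · have hd := H.pair_eq (add i q hiq)
      simp only [ev, hi, H.coord_q] at hd
      have hb := pair_nonneg H.right (add i q hiq)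
      refine H.smul_eq_zero_of_sum hv hspan
        (isRootSum_sub (lt_of_le_of_lt hjp h) hiq.ne' (isSumRoot_add i j hij)
          (isSumRoot_add i q hiq)) ?_ hstep (by omega) ht
      rw [ev, hj, H.coord_q]; rfl

/-- If `x_β⁻ ⊗ t^s` kills a vector satisfying the relations of `V(a, b)`, then it satisfies the
relations of `D(2, a + b)`. -/
theorem satisfies_dRel (H : IsMinimalPair a b p q h L) (hv : Satisfies (VRel a b) v)
    (hspan : Submodule.span (U n) {v} = ⊤)
    (h0 : ∀ t : ℕ, (t : ℤ) = pair a (add p q h) - 1 → cur (xMinus (add p q h)) t • v = 0) :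
    Satisfies (DRel 2 (a + b)) v := by
  have hbound : ∀ (α : PosRoot n) (s m : ℕ), pair a α + pair b α = 2 * ((s : ℤ) - 1) + m → 0 < m →
      m ≤ 2 → cur (xMinus α) s • v = 0 := by
    intro α s m hp hm hm2
    have hd := H.pair_eq α
    have hle := H.ev_le α
    by_cases h2 : α.ev L = 2
    · exact H.smul_eq_zero_of_ev_two hv hspan h0 h2 (by omega)
    -- Away from L-value 2 the pairings with a and b differ by at most one, so their maximum is at
    -- most s.
    · exact H.smul_eq_zero hv hspan (by omega) (by omega)
  rintro u (⟨u, hu⟩ | ⟨α, s, m, hp, hm, hm2⟩ | ⟨α, s, m, hp, hm, hm2, hs⟩)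
  · exact weyl hv u hu
  · rw [pair_add_weight] at hp
    exact hbound α s m hp hm hm2
  · rw [pair_add_weight] at hp
    have hsl := H.isSl2LoopVector hv hspan α
    refine hsl.top_pow_smul (isSl2Loop_cur α) (fun i hi => hsl.smul_eq_zero_of_le
      (isSl2Loop_cur α) (hbound α s m hp hm hm2) (by omega)) ?_
    -- The required inequality is 2(s - 1) + m < (m + 1)s, which holds for m = 1, 2 and s ≥ 1.
    rw [Nat.sub_add_cancel hs]
    obtain rfl | rfl : m = 1 ∨ m = 2 := by omega
    · push_cast at hp ⊢; omega
    · push_cast at hp ⊢; omega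

/-- A vector satisfying the relations of `D(2, a + b)` satisfies the relations of `V(a, b)`, and it
is killed by `x_β⁻ ⊗ t^s`. -/
theorem satisfies_vRel (H : IsMinimalPair a b p q h L) (hv : Satisfies (DRel 2 (a + b)) v)
    (hspan : Submodule.span (U n) {v} = ⊤) : Satisfies (VRel a b) v ∧
      ∀ t : ℕ, (t : ℤ) = pair a (add p q h) - 1 → cur (xMinus (add p q h)) t • v = 0 := by
  have hw : Satisfies (WeylRel (a + b)) v := fun u hu => hv u (.weyl u hu)
  have hbound : ∀ (α : PosRoot n) (t : ℕ), pair a α + pair b α ≤ 2 * t →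
      cur (xMinus α) t • v = 0 := by
    intro α t ht
    have ha := pair_nonneg H.left α
    have hb := pair_nonneg H.right α
    have hnil := hw.isLocNilp (fun i => add_nonneg (H.left i) (H.right i)) hspan α
    obtain ⟨k, hk⟩ : ∃ k : ℕ, (k : ℤ) = pair a α + pair b α := ⟨_, Int.toNat_of_nonneg (by omega)⟩
    -- Writing k = 2(s - 1) + m with m in {1, 2} gives s = ⌈k/2⌉, and m = 2 exactly for even k.
    have h1 := hv _ (.bound α ((k + 1) / 2) (if k % 2 = 0 then 2 else 1) (by
      rw [pair_add_weight]; push_cast; split_ifs <;> omega) (by split_ifs <;> omega)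
      (by split_ifs <;> omega))
    exact (hw.isSl2LoopVector hnil).smul_eq_zero_of_le (isSl2Loop_cur α) h1 (by omega)
  constructor
  · rintro u (⟨u, hu⟩ | ⟨α, t, ht⟩)
    · exact hw u hu
    · exact hbound α t (by omega)
  · intro t ht
    have := H.pair_beta
    exact hbound _ t (by omega)

end IsMinimalPair

/-! ### Dominance of a - β -/

theorem exists_isSimple (hn : 2 ≤ n) (i : Fin n) : ∃ α : PosRoot n, α.coeff = Pi.single i 1 := by
  by_cases hi : (i : ℕ) + 1 < n
  · have h : i < (⟨i + 1, hi⟩ : Fin n) := by rw [Fin.lt_def]; simp only; omega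
    refine ⟨sub i ⟨i + 1, hi⟩ h, ?_⟩
    ext k
    simp only [coeff, Pi.single_apply, Fin.le_def, Fin.lt_def, Fin.ext_iff]
    split_ifs <;> omega
  · have hk : n - 2 < n := by omega
    have h : (⟨n - 2, hk⟩ : Fin n) < i := by rw [Fin.lt_def]; simp only; omega
    refine ⟨add ⟨n - 2, hk⟩ i h, ?_⟩
    ext k
    simp only [coeff, Pi.single_apply, Fin.le_def, Fin.ext_iff]
    split_ifs <;> omega

theorem pair_of_coeff_eq_single {α : PosRoot n} {i : Fin n} (h : α.coeff = Pi.single i 1)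
    (lam : Weight n) : pair lam α = lam i := by
  rw [pair, h, Finset.sum_eq_single i]
  · simp
  · intro k _ hk
    simp [hk]
  · simp

/-- Only simple α with positive inner product with β matter. If β = α + δ then L(α) = 1 gives a(h_α)
≥ 1; if α = β or α = β + δ then a(h_α) ≥ a(h_β) ≥ 2. -/
theorem IsMinimalPair.isDominant_sub {a b : Weight n} {p q : Fin n} {h : p < q} {L : ℕ → ℤ}
    (H : IsMinimalPair a b p q h L) (hn : 3 ≤ n) :
    IsDominant (a - rootWeight (add p q h)) := by
  intro i
  obtain ⟨α, hα⟩ := exists_isSimple (by omega) i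
  rw [← pair_of_coeff_eq_single hα (a - rootWeight _), pair_sub_weight, pair_rootWeight hn]
  have hβ := H.pair_beta
  have hβb := pair_nonneg H.right (add p q h)
  have hαa := pair_nonneg H.left α
  have hαb := pair_nonneg H.right α
  rcases lie_xMinus_cases α p q h with rfl | ⟨hip, -⟩ | ⟨hip, -⟩ | ⟨hip, -, ⟨δ, hδ⟩ | ⟨δ, hδ, -, -⟩⟩
  · rw [ev_vec_self]; omega
  · omega
  · omega
  · have := (H.ev_of_sum hδ.ev_eq).1
    have := H.pair_eq α
    omega
  · have := pair_eq_of_ev hδ.ev_eq a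
    have := pair_nonneg H.left δ
    omega

/-! ### Modules given by presentations -/

theorem uPiece_smul_mem (N : GrMod n) {k l : ℤ} {u : U n} (hu : u ∈ uPiece n k) {x : N.carrier}
    (hx : x ∈ N.piece l) : u • x ∈ N.piece (l + k) := by
  induction hu using Submodule.span_induction with
  | zero => rw [zero_smul]; exact Submodule.zero_mem _
  | add u v _ _ hu hv => rw [add_smul]; exact Submodule.add_mem _ hu hv
  | smul c u _ hu => rw [smul_assoc]; exact Submodule.smul_mem _ _ hu
  | mem u hu =>
    obtain ⟨m, rfl, rfl⟩ := hu
    induction m with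
    | nil => simpa using hx
    | cons a m ih =>
      have := N.cur_smul_mem a.1 a.2 _ _ ih
      rw [← mul_smul] at this
      simp only [List.map_cons, List.prod_cons, List.sum_cons]
      rwa [show l + (((a.2 + (m.map Prod.snd).sum : ℕ)) : ℤ) =
        l + ((m.map Prod.snd).sum : ℕ) + (a.2 : ℤ) by push_cast; ring]

section

variable (S : Set (U n)) (hS : ∀ u ∈ S, ∃ k, u ∈ uPiece n k)

theorem presentedGen_satisfies : Satisfies (· ∈ S) (presentedGen S hS) := by
  intro u hu
  change Submodule.Quotient.mk (u • (1 : U n)) = (0 : U n ⧸ Submodule.span (U n) S)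
  rw [smul_eq_mul, mul_one, Submodule.Quotient.mk_eq_zero]
  exact Submodule.subset_span hu

theorem span_presentedGen : Submodule.span (U n) {presentedGen S hS} = ⊤ := by
  rw [eq_top_iff]
  intro x _
  obtain ⟨u, rfl⟩ := Submodule.Quotient.mk_surjective _ x
  refine Submodule.mem_span_singleton.2 ⟨u, ?_⟩
  change Submodule.Quotient.mk (u • (1 : U n)) = _
  rw [smul_eq_mul, mul_one]

theorem presentedGen_mem_piece : presentedGen S hS ∈ (presented S hS).piece 0 := by
  refine ⟨1, ?_, rfl⟩
  have := algebraMap_mem (n := n) 1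
  rwa [map_one] at this

/-- The linear map from a presented module sending the generator to a vector which satisfies the
relations. -/
noncomputable def presentedLift {N : Type*} [AddCommGroup N] [Module (U n) N] {x : N}
    (hx : Satisfies (· ∈ S) x) : (presented S hS).carrier →ₗ[U n] N :=
  (Submodule.span (U n) S).liftQ (LinearMap.toSpanSingleton (U n) N x)
    (Submodule.span_le.2 fun u hu => hx u hu)

theorem presentedLift_gen {N : Type*} [AddCommGroup N] [Module (U n) N] {x : N}
    (hx : Satisfies (· ∈ S) x) : presentedLift S hS hx (presentedGen S hS) = x := by
  change (1 : U n) • x = x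
  rw [one_smul]

theorem presentedLift_mem_piece {N : GrMod n} {x : N.carrier} (hx : Satisfies (· ∈ S) x) {l : ℤ}
    (hl : x ∈ N.piece l) (k : ℤ) (y : (presented S hS).carrier) (hy : y ∈ (presented S hS).piece k) :
    presentedLift S hS hx y ∈ N.piece (l + k) := by
  obtain ⟨u, hu, rfl⟩ := hy
  exact uPiece_smul_mem N hu hl

end

theorem range_eq_span {M N : Type*} [AddCommGroup M] [AddCommGroup N] [Module (U n) M]
    [Module (U n) N] (f : M →ₗ[U n] N) {x : M} (hx : Submodule.span (U n) {x} = ⊤) :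
    LinearMap.range f = Submodule.span (U n) {f x} := by
  rw [LinearMap.range_eq_map, ← hx, Submodule.map_span, Set.image_singleton]

end TypeD

/-! ### The right exact sequence -/

open TypeD in
theorem mainTheorem3 (n : ℕ) (hn : 4 ≤ n) (lam₁ lam₂ nu : TypeD.Weight n)
    (hlam₁ : TypeD.IsDominantOne lam₁) (hlam₂ : TypeD.IsDominantOne lam₂)
    (hint : TypeD.IsInterlacing lam₁ lam₂) (hnu : TypeD.IsDominant nu)
    (hR : (TypeD.RSet lam₁ lam₂).Nonempty)
    (β : TypeD.PosRoot n) (hβ : TypeD.IsBeta lam₁ lam₂ β)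
    (hlt : TypeD.pair lam₂ β < TypeD.pair lam₁ β) :
    TypeD.IsDominant (lam₁ + nu - TypeD.rootWeight β) ∧
    ∃ s : ℕ, (s : ℤ) = TypeD.pair (nu + lam₁) β - 1 ∧
    ∃ (f : TypeD.GrHom ((TypeD.V (lam₁ + nu - TypeD.rootWeight β) (lam₂ + nu)).shift s)
          (TypeD.V (lam₁ + nu) (lam₂ + nu)))
      (p : TypeD.GrHom (TypeD.V (lam₁ + nu) (lam₂ + nu)) (TypeD.D 2 (lam₁ + lam₂ + 2 • nu))),
      f.toLin (TypeD.vGen (lam₁ + nu - TypeD.rootWeight β) (lam₂ + nu)) =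
        TypeD.cur (TypeD.xMinus β) s • TypeD.vGen (lam₁ + nu) (lam₂ + nu) ∧
      p.toLin (TypeD.vGen (lam₁ + nu) (lam₂ + nu)) = TypeD.dGen 2 (lam₁ + lam₂ + 2 • nu) ∧
      Function.Exact f.toLin p.toLin ∧ Function.Surjective p.toLin := by
  obtain ⟨p, q, h, L, rfl, hL, hLp, hLq, hmax, hLd⟩ :=
    hβ.exists_coord (by omega) hlam₁ hlam₂ hint hlt
  have H : IsMinimalPair (lam₁ + nu) (lam₂ + nu) p q h L :=
    { left := fun i => add_nonneg (hlam₁ i).1 (hnu i)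
      right := fun i => add_nonneg (hlam₂ i).1 (hnu i)
      coord := hL
      coord_p := hLp
      coord_q := hLq
      maximal := hmax
      pair_eq := fun α => by rw [pair_add_weight, pair_add_weight, ← hLd]; ring }
  refine ⟨H.isDominant_sub (by omega), ?_⟩
  rw [show lam₁ + lam₂ + 2 • nu = lam₁ + nu + (lam₂ + nu) by rw [two_smul]; abel, add_comm nu lam₁]
  have hβ2 := H.pair_beta
  have hβ0 := pair_nonneg H.right (PosRoot.add p q h)
  generalize lam₁ + nu = a at *
  generalize lam₂ + nu = b at *
  obtain ⟨s, hs⟩ : ∃ s : ℕ, (s : ℤ) = pair a (PosRoot.add p q h) - 1 :=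
    ⟨_, Int.toNat_of_nonneg (by omega)⟩
  have hv : Satisfies (VRel a b) (vGen a b) := presentedGen_satisfies _ VRel.homogeneous
  have hvspan : Submodule.span (U n) {vGen a b} = ⊤ := span_presentedGen _ VRel.homogeneous
  have hd : Satisfies (DRel 2 (a + b)) (dGen 2 (a + b)) :=
    presentedGen_satisfies _ DRel.homogeneous
  have hdspan : Submodule.span (U n) {dGen 2 (a + b)} = ⊤ := span_presentedGen _ DRel.homogeneous
  obtain ⟨hdv, hds⟩ := H.satisfies_vRel hd hdspan
  have hx := H.satisfies_smul (by omega) hv hvspan hs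
  have hv0 : vGen a b ∈ (V a b).piece 0 := presentedGen_mem_piece _ VRel.homogeneous
  have hd0 : dGen 2 (a + b) ∈ (D 2 (a + b)).piece 0 := presentedGen_mem_piece _ DRel.homogeneous
  let f : GrHom ((V (a - rootWeight (PosRoot.add p q h)) b).shift s) (V a b) :=
    { toLin := presentedLift _ VRel.homogeneous hx
      map_piece := fun k y hy => by
        have := presentedLift_mem_piece _ VRel.homogeneous hx
          ((V a b).cur_smul_mem (xMinus (PosRoot.add p q h)) s 0 _ hv0) (k - s) y hy
        -- The shift cancels the degree s of the image of the generator.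
        rwa [show (0 : ℤ) + s + (k - s) = k by ring] at this }
  let π : GrHom (V a b) (D 2 (a + b)) :=
    { toLin := presentedLift _ VRel.homogeneous hdv
      map_piece := fun k y hy => by
        have := presentedLift_mem_piece _ VRel.homogeneous hdv hd0 k y hy
        rwa [zero_add] at this }
  have hf : f.toLin (vGen (a - rootWeight (PosRoot.add p q h)) b) =
      cur (xMinus (PosRoot.add p q h)) s • vGen a b := presentedLift_gen _ VRel.homogeneous hx
  have hπ : π.toLin (vGen a b) = dGen 2 (a + b) := presentedLift_gen _ VRel.homogeneous hdv
  have hrange : LinearMap.range f.toLin =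
      Submodule.span (U n) {cur (xMinus (PosRoot.add p q h)) s • vGen a b} := by
    rw [← hf]
    exact range_eq_span f.toLin (span_presentedGen _ VRel.homogeneous)
  refine ⟨s, hs, f, π, hf, hπ, ?_, ?_⟩
  · rw [LinearMap.exact_iff]
    apply le_antisymm
    -- The generator of V(a, b) modulo the image satisfies the relations of D(2, a + b). This gives
    -- a map from D(2, a + b) back to the quotient, and its composite with π is the quotient map, so
    -- the kernel of π lies in the image.
    · let R := LinearMap.range f.toLin
      let w : (V a b).carrier ⧸ R := R.mkQ (vGen a b)
      have hw : Satisfies (VRel a b) w := fun u hu => by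
        rw [← map_smul, hv u hu, map_zero]
      have hwspan : Submodule.span (U n) {w} = ⊤ := by
        rw [← range_eq_span R.mkQ hvspan, Submodule.range_mkQ]
      have hw0 : ∀ t : ℕ, (t : ℤ) = pair a (PosRoot.add p q h) - 1 →
          cur (xMinus (PosRoot.add p q h)) t • w = 0 := by
        intro t ht
        obtain rfl : t = s := by omega
        rw [← map_smul, Submodule.mkQ_apply, Submodule.Quotient.mk_eq_zero]
        exact ⟨_, hf⟩
      have hD := H.satisfies_dRel hw hwspan hw0
      let ψ : (D 2 (a + b)).carrier →ₗ[U n] (V a b).carrier ⧸ R :=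
        presentedLift _ DRel.homogeneous hD
      have hψ : ψ (dGen 2 (a + b)) = w := presentedLift_gen _ DRel.homogeneous hD
      have hcomp : ψ.comp π.toLin = R.mkQ := by
        refine LinearMap.ext_on hvspan ?_
        rintro _ rfl
        rw [LinearMap.comp_apply, hπ, hψ]
      intro y hy
      rw [LinearMap.mem_ker] at hy
      have := LinearMap.congr_fun hcomp y
      rw [LinearMap.comp_apply, hy, map_zero, eq_comm, Submodule.mkQ_apply,
        Submodule.Quotient.mk_eq_zero] at this
      exact this
    · rw [hrange, Submodule.span_singleton_le_iff_mem, LinearMap.mem_ker, map_smul, hπ]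
      exact hds s hs
  · rw [← LinearMap.range_eq_top, range_eq_span _ hvspan, hπ]
    exact hdspan
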